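/- Let $p$ be a prime and let $G$ be a $p$-group of maximal class, that is, $|G|=p^n$ and $G$ has nilpotency class $n-1$, where we assume $n\ge 4$. Let $\gamma_i(G)$ be the terms of the lower central series of $G$ (with $\gamma_1(G)=G$), let $\Phi(G)$ be the Frattini subgroup of $G$, and put $G_1=C_G(\gamma_2(G)/\gamma_4(G))$. For a maximal subgroup $M$ of $G$ let $B(M)=M\smallsetminus\Phi(G)$, and let $\mu(G)$ be the number of maximal subgroups $M\ne G_1$ of $G$ such that all elements of $B(M)$ have order $p$. If $G$ is metabelian or $G_1$ has nilpotency class at most $2$, then $\mu(G)\in\{0,1,2,p\}$. Furthermore, if $G$ has an abelian maximal subgroup, then $\mu(G)\in\{0,1,p\}$. -/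

import Mathlib

/-- `G` is a (finite) `p`-group of maximal class of order `p ^ n`: its order is `p ^ n` with `2 ≤ n`,
and its nilpotency class is `n - 1`. -/
structure IsMaximalClass (p n : ℕ) (G : Type*) [Group G] : Prop where
  two_le : 2 ≤ n
  card_eq : Nat.card G = p ^ n
  isNilpotent : Group.IsNilpotent G
  nilpotencyClass_eq : Group.nilpotencyClass G = n - 1

/-- The `i`-th term `γ_i(G)` of the lower central series, for `1 ≤ i`, with the usual numbering
`γ_1(G) = G`, `γ_2(G) = G'` (Mathlib's numbering starts at `0`). -/
def lcsTerm (G : Type*) [Group G] (i : ℕ) : Subgroup G :=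
  (⊤ : Subgroup G).lowerCentralSeries (i - 1)

instance lcsTerm_normal (G : Type*) [Group G] (i : ℕ) : (lcsTerm G i).Normal := by
  unfold lcsTerm
  infer_instance

/-- The subgroup `G_1 = C_G(γ_2(G) / γ_4(G))`: the elements of `G` whose image in `G / γ_4(G)`
centralizes `γ_2(G) / γ_4(G)`. -/
def gOne (G : Type*) [Group G] : Subgroup G :=
  (Subgroup.centralizer
    (((lcsTerm G 2).map (QuotientGroup.mk' (lcsTerm G 4)) : Subgroup (G ⧸ lcsTerm G 4)) :
      Set (G ⧸ lcsTerm G 4))).comap (QuotientGroup.mk' (lcsTerm G 4))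

/-- `G` is metabelian: its second derived subgroup is trivial. -/
def IsMetabelianGroup (G : Type*) [Group G] : Prop :=
  derivedSeries G 2 = ⊥

/-- The maximal branch `B(M) = M \ Φ(G)`. -/
def maximalBranch {G : Type*} [Group G] (M : Subgroup G) : Set G :=
  (M : Set G) \ (frattini G : Set G)

/-- The number `μ(G)` of maximal subgroups `M ≠ G_1` of the `p`-group `G` such that all elements
of `B(M)` have order `p`. -/
noncomputable def mu (p : ℕ) (G : Type*) [Group G] : ℕ :=
  Set.ncard {M : Subgroup G |
    IsCoatom M ∧ M ≠ gOne G ∧ ∀ x ∈ maximalBranch M, orderOf x = p}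

/-! Here Φ(G) = G' has index p², so for s ∉ G_1 and t ∈ G_1 ∖ Φ(G) the maximal subgroups other than
G_1 are Φ(G)⟨t^k s⟩ with 0 ≤ k < p. Such a subgroup is counted by μ exactly when (a t^k s)^p = 1 for
all a ∈ Φ(G). It suffices that if this holds for k = 0, 1 and some j with 2 ≤ j < p, then it holds
for all k; if G_1 is abelian, k = 0, 1 must suffice. The reason is that (t^k s)^p is "quadratic" in
k, and "linear" when G_1 is abelian.

If G_1 has class at most 2, collection gives (t^k s)^p = q^k c^{C(k,2)} s^p with c a commutator term
(`exists_mul_pow_eq_of_commute`). The values 0, 1, j kill q and then c, since C(j,2) is prime to p.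

If G is metabelian, G' is a faithful module over a commutative ring through which G acts. Let s and
t act as 1 + x and τ. Since t centralizes γ_2/γ_4, a Nakayama argument gives τ = 1 + x²y
(`exists_sub_one_eq_sq_mul`). A coset Φ(G)g has exponent dividing p iff g^p = 1 and the norm 1 +
ρ(g) + ⋯ + ρ(g)^(p-1) vanishes. Vanishing of the norms of s and ts forces p·x²y = 0 and x^(p-2)·x²y
= 0. These relations make all other norms vanish, and they make the step from (t^k s)^p to (t^(k+1)
s)^p affine in k (`exists_twisted_geomSum_eq`). This needs p ≥ 5; for smaller p the bound μ ≤ p is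
enough. -/

/-! ### The norm polynomial modulo p -/

-- The sum is ((1 + X)^p - 1)/X, whose middle binomial coefficients are divisible by p. The constant
-- term 1 makes r(x) a unit for nilpotent x.
open Polynomial in
theorem exists_geomSum_one_add_X_eq {p : ℕ} (hp : p.Prime) :
    ∃ r : ℤ[X], r.eval 0 = 1 ∧
      ∑ i ∈ Finset.range p, (1 + X : ℤ[X]) ^ i = X ^ (p - 1) + (p : ℤ[X]) * r := by
  refine ⟨∑ k ∈ Finset.Ioo 0 p, X ^ (k - 1) * 1 ^ (p - k - 1) * ((p.choose k / p : ℕ) : ℤ[X]),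
    ?_, ?_⟩
  · rw [eval_finsetSum, Finset.sum_eq_single 1]
    · simp [Nat.div_self hp.pos]
    · intro k hk hk1
      have : k - 1 ≠ 0 := by have := (Finset.mem_Ioo.mp hk).1; omega
      simp [this]
    · intro h
      exact absurd (Finset.mem_Ioo.mpr ⟨one_pos, hp.one_lt⟩) h
  · apply mul_left_cancel₀ (X_ne_zero (R := ℤ))
    have h := geom_sum_mul (1 + X : ℤ[X]) p
    have h2 := add_pow_prime_eq hp (X : ℤ[X]) 1
    have h3 : (X : ℤ[X]) * X ^ (p - 1) = X ^ p := by
      rw [← pow_succ', Nat.sub_add_cancel hp.pos]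
    rw [add_sub_cancel_left, add_comm 1 X, h2] at h
    rw [mul_comm, add_comm 1 X, h, mul_add, h3, one_pow]
    ring

/-- Translation invariance of the divided difference of `1 + T + ⋯ + T ^ (p - 1)`. -/
theorem exists_dividedDifference_geomSum_eq {p : ℕ} (hp : p.Prime) :
    ∃ q : MvPolynomial (Fin 2) ℤ,
      ∑ j ∈ Finset.range p, ∑ i ∈ Finset.range j,
          (1 + MvPolynomial.X 0 : MvPolynomial (Fin 2) ℤ) ^ i *
            (1 + MvPolynomial.X 1) ^ (j - 1 - i) =
        ∑ i ∈ Finset.range (p - 1), MvPolynomial.X 0 ^ i * MvPolynomial.X 1 ^ (p - 1 - 1 - i) +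
          p * q := by
  obtain ⟨r, -, hr⟩ := exists_geomSum_one_add_X_eq hp
  set a : MvPolynomial (Fin 2) ℤ := MvPolynomial.X 0
  set c : MvPolynomial (Fin 2) ℤ := MvPolynomial.X 1
  obtain ⟨q, hq⟩ := Polynomial.sub_dvd_eval_sub a c
    (r.map (algebraMap ℤ (MvPolynomial (Fin 2) ℤ)))
  have key (x : MvPolynomial (Fin 2) ℤ) : ∑ i ∈ Finset.range p, (1 + x) ^ i = x ^ (p - 1) +
      p * (r.map (algebraMap ℤ (MvPolynomial (Fin 2) ℤ))).eval x := by
    have := congrArg (Polynomial.aeval x) hr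
    rw [Polynomial.eval_map_algebraMap]
    simpa using this
  have hac : a - c ≠ 0 := by
    rw [sub_ne_zero]
    exact fun h => absurd (MvPolynomial.X_injective h) (by decide)
  -- Multiplied by a - c, the double sum telescopes to the norm of 1 + a minus that of 1 + c.
  refine ⟨q, mul_right_cancel₀ hac ?_⟩
  have h1 : ∀ j, (∑ i ∈ Finset.range j, (1 + a) ^ i * (1 + c) ^ (j - 1 - i)) * (a - c) =
      (1 + a) ^ j - (1 + c) ^ j := fun j => by
    rw [← (Commute.all (1 + a) (1 + c)).geom_sum₂_mul]; ring
  rw [Finset.sum_mul, Finset.sum_congr rfl fun j _ => h1 j, Finset.sum_sub_distrib, key, key,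
    add_mul, (Commute.all a c).geom_sum₂_mul]
  linear_combination (p : MvPolynomial (Fin 2) ℤ) * hq

/-! ### Relations forced by vanishing norms -/

section GeomSum

variable {R : Type*} [CommRing R]

/-- First-order expansion in x²y. The remainder keeps the factor x^(l+1)·x²y, so that the relations
found below annihilate it. -/
theorem exists_add_mul_pow_eq {x y e : R} (l : ℕ) :
    ∃ z, (x + x ^ 2 * y * e) ^ (l + 1) =
      x ^ (l + 1) + (l + 1) * e * (x ^ l * (x ^ 2 * y)) + x ^ (l + 1) * (x ^ 2 * y) * z := by
  induction l with
  | zero => exact ⟨0, by simp; ring⟩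
  | succ l ih =>
    obtain ⟨z, hz⟩ := ih
    refine ⟨z + (l + 1) * e ^ 2 * y + x * y * z * e, ?_⟩
    rw [pow_succ, hz]
    push_cast
    ring

variable {p : ℕ} {x y : R}

/-- The vanishing norm says x^(p-1) = -pu with u a unit. Substituting this into (1 + x²y)^p - 1 = 0
gives p·x²y times a unit, because the other terms carry a further nilpotent factor. -/
theorem natCast_mul_eq_zero_of_geomSum_eq_zero (hp : p.Prime) (h3 : 3 ≤ p) (hx : IsNilpotent x)
    (hN : ∑ i ∈ Finset.range p, (1 + x) ^ i = 0) (ht : (1 + x ^ 2 * y) ^ p = 1) :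
    (p : R) * (x ^ 2 * y) = 0 ∧ x ^ (p - 1) * (x ^ 2 * y) = 0 := by
  obtain ⟨r, hr0, hr⟩ := exists_geomSum_one_add_X_eq hp
  have key (x : R) : ∑ i ∈ Finset.range p, (1 + x) ^ i = x ^ (p - 1) +
      p * r.aeval x := by
    have := congrArg (Polynomial.aeval x) hr
    simpa using this
  have hr' (x : R) : r.aeval x = 1 + x * r.divX.aeval x := by
    conv_lhs => rw [← r.divX_mul_X_add, Polynomial.coeff_zero_eq_eval_zero, hr0]
    simp; ring
  obtain ⟨u, hu⟩ : IsUnit (r.aeval x) := by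
    rw [hr']
    exact ((Commute.all _ _).isNilpotent_mul_right hx).isUnit_one_add
  rw [key, ← hu] at hN
  have hpu : x ^ (p - 1) = - p * u := by linear_combination hN
  have h1 := mul_geom_sum (1 + x ^ 2 * y) p
  rw [ht, key, hr', sub_self, add_sub_cancel_left, mul_pow, ← pow_mul, mul_comm 2, pow_mul,
    hpu] at h1
  obtain ⟨m, rfl⟩ : ∃ m, p = m + 3 := ⟨p - 3, by omega⟩
  have hxm : x ^ (m + 3 - 1) = x * x ^ (m + 1) := by rw [← pow_succ']; rfl
  have h0 : ((m + 3 : ℕ) : R) * (x ^ 2 * y) = 0 := by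
    have hn : IsNilpotent (x * (x * y * (r.divX.aeval (x ^ 2 * y)) -
        x ^ (m + 1) * u * y ^ (m + 3 - 1))) := (Commute.all _ _).isNilpotent_mul_right hx
    have := hn.isUnit_one_add
    rw [← this.mul_left_eq_zero]
    have e := hpu
    rw [hxm] at e
    linear_combination h1 - (x ^ 2 * y) * u * y ^ (m + 3 - 1) * ((m + 3 : ℕ) : R) * e
  exact ⟨h0, by linear_combination (x ^ 2 * y) * hpu - u * h0⟩

theorem one_add_pow_eq_one_add_mul_geomSum (t : R) (k : ℕ) :
    (1 + t) ^ k = 1 + t * ∑ i ∈ Finset.range k, (1 + t) ^ i := by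
  have := mul_geom_sum (1 + t) k
  linear_combination -this

theorem geomSum_mul_pow_eq_zero (hp : p.Prime) (h3 : 3 ≤ p) (hx : IsNilpotent x)
    (hN : ∑ i ∈ Finset.range p, (1 + x) ^ i = 0) (ht : (1 + x ^ 2 * y) ^ p = 1)
    (hN1 : ∑ i ∈ Finset.range p, ((1 + x) * (1 + x ^ 2 * y)) ^ i = 0) :
    x ^ (p - 2) * (x ^ 2 * y) = 0 ∧
      ∀ k, ∑ i ∈ Finset.range p, ((1 + x) * (1 + x ^ 2 * y) ^ k) ^ i = 0 := by
  obtain ⟨hpy, hxy⟩ := natCast_mul_eq_zero_of_geomSum_eq_zero hp h3 hx hN ht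
  obtain ⟨r, -, hr⟩ := exists_geomSum_one_add_X_eq hp
  have key (x : R) : ∑ i ∈ Finset.range p, (1 + x) ^ i = x ^ (p - 1) +
      p * r.aeval x := by
    have := congrArg (Polynomial.aeval x) hr
    simpa using this
  -- As p·x²y = 0, only the leading term x^(p-1) of the norm feels the perturbation, and only to
  -- first order.
  have main (e : R) : ∑ i ∈ Finset.range p, (1 + (x + x ^ 2 * y * e)) ^ i =
      (p - 1) * e * (x ^ (p - 2) * (x ^ 2 * y)) := by
    obtain ⟨z, hz⟩ := exists_add_mul_pow_eq (x := x) (y := y) (e := e) (p - 2)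
    have hp2 : p - 2 + 1 = p - 1 := by omega
    have hpc : ((p - 2 : ℕ) : R) = p - 2 := by
      rw [Nat.cast_sub (by omega)]; rfl
    rw [hp2, hpc] at hz
    obtain ⟨q, hq⟩ := Polynomial.sub_dvd_eval_sub (x + x ^ 2 * y * e) x
      (r.map (algebraMap ℤ R))
    rw [Polynomial.eval_map_algebraMap, Polynomial.eval_map_algebraMap] at hq
    rw [key] at hN ⊢
    linear_combination hN + hz + p * hq + z * hxy + q * e * hpy
  have hpow (k : ℕ) : (1 + x) * (1 + x ^ 2 * y) ^ k = 1 + (x + x ^ 2 * y *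
      ((1 + x) * ∑ i ∈ Finset.range k, (1 + x ^ 2 * y) ^ i)) := by
    rw [one_add_pow_eq_one_add_mul_geomSum]; ring
  have h0 : x ^ (p - 2) * (x ^ 2 * y) = 0 := by
    have h1 := hpow 1
    rw [pow_one] at h1
    rw [h1, main] at hN1
    have hp2 : x ^ (p - 1) = x ^ (p - 2) * x := by rw [← pow_succ]; congr 1; omega
    rw [hp2] at hxy
    simp only [Finset.range_one, Finset.sum_singleton, pow_zero, mul_one] at hN1
    linear_combination (p - 1) * hxy - hN1 + x ^ (p - 2) * hpy
  exact ⟨h0, fun k => by rw [hpow, main, h0, mul_zero]⟩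

theorem exists_twisted_geomSum_eq (hp : p.Prime) (h4 : 4 ≤ p)
    (hpy : (p : R) * (x ^ 2 * y) = 0) (hxy : x ^ (p - 2) * (x ^ 2 * y) = 0) :
    ∃ κ : R, ∀ k : ℕ, (1 + x ^ 2 * y) ^ k * ∑ j ∈ Finset.range p, (1 + x ^ 2 * y) ^ j *
        ∑ i ∈ Finset.range j, ((1 + x) * (1 + x ^ 2 * y) ^ k) ^ i =
      κ + (p - 2) * (k + 1) * (x ^ (p - 3) * (x ^ 2 * y)) := by
  obtain ⟨q, hq⟩ := exists_dividedDifference_geomSum_eq hp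
  have key (a c : R) : ∑ j ∈ Finset.range p, ∑ i ∈ Finset.range j,
      (1 + a) ^ i * (1 + c) ^ (j - 1 - i) =
        ∑ i ∈ Finset.range (p - 1), a ^ i * c ^ (p - 1 - 1 - i) + p * q.aeval ![a, c] := by
    have := congrArg (MvPolynomial.aeval ![a, c]) hq
    simpa using this
  obtain ⟨m, rfl⟩ : ∃ m, p = m + 4 := ⟨p - 4, by omega⟩
  simp only [show m + 4 - 2 = m + 2 by omega, show m + 4 - 3 = m + 1 by omega,
    show m + 4 - 1 = m + 3 by omega, show m + 3 - 1 = m + 2 by omega] at *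
  set t := x ^ 2 * y with ht
  have htt : t * (x ^ (m + 1) * t) = 0 := by
    linear_combination x * y * hxy + x ^ (m + 1) * t * ht
  have hpow (k : ℕ) : ∃ z, (1 + t) ^ k = 1 + k * t + t ^ 2 * z := by
    induction k with
    | zero => exact ⟨0, by simp⟩
    | succ k ih =>
      obtain ⟨z, hz⟩ := ih
      exact ⟨z + k + t * z, by rw [pow_succ, hz]; push_cast; ring⟩
  -- Modulo t the arguments become (x, 0), and p·t = 0.
  have hq' (a : R) (e : R) (ha : a = x + t * e) : ((m + 4 : ℕ) : R) * q.aeval ![a, t] =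
      ((m + 4 : ℕ) : R) * q.aeval ![x, 0] := by
    have : Ideal.Quotient.mk (Ideal.span {t}) (q.aeval ![a, t]) =
        Ideal.Quotient.mk (Ideal.span {t}) (q.aeval ![x, 0]) := by
      have ht0 : Ideal.Quotient.mk (Ideal.span {t}) t = 0 :=
        Ideal.Quotient.eq_zero_iff_mem.mpr (Ideal.mem_span_singleton_self t)
      have hh (v : Fin 2 → R) : Ideal.Quotient.mk (Ideal.span {t}) (q.aeval v) =
          q.aeval (fun i => Ideal.Quotient.mk (Ideal.span {t}) (v i)) :=
        MvPolynomial.comp_aeval_apply v (Ideal.Quotient.mk (Ideal.span {t})).toIntAlgHom q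
      rw [hh, hh]
      congr 2
      funext i
      fin_cases i <;> simp [ha, ht0]
    rw [Ideal.Quotient.eq, Ideal.mem_span_singleton] at this
    obtain ⟨c, hc⟩ := this
    linear_combination ((m + 4 : ℕ) : R) * hc + c * hpy
  refine ⟨x ^ (m + 2) + x ^ (m + 1) * t + ((m + 4 : ℕ) : R) * q.aeval ![x, 0], fun k => ?_⟩
  -- One factor 1 + t moved inside turns the sum into the divided difference of the norm at (1 +
  -- x)(1 + t)^(k+1) and 1 + t.
  have hsum : (1 + t) ^ k * ∑ j ∈ Finset.range (m + 4), (1 + t) ^ j *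
        ∑ i ∈ Finset.range j, ((1 + x) * (1 + t) ^ k) ^ i =
      (1 + t) ^ (k + 1) * ∑ j ∈ Finset.range (m + 4), ∑ i ∈ Finset.range j,
        ((1 + x) * (1 + t) ^ (k + 1)) ^ i * (1 + t) ^ (j - 1 - i) := by
    rw [pow_succ, mul_assoc, Finset.mul_sum (a := 1 + t)]
    congr 1
    refine Finset.sum_congr rfl fun j _ => ?_
    rw [Finset.mul_sum, Finset.mul_sum]
    refine Finset.sum_congr rfl fun i hi => ?_
    have hi := Finset.mem_range.mp hi
    obtain ⟨l, rfl⟩ : ∃ l, j = i + 1 + l := ⟨j - 1 - i, by omega⟩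
    rw [show i + 1 + l - 1 - i = l by omega, ← mul_assoc (1 + x), mul_pow _ (1 + t)]
    ring
  obtain ⟨z, hz⟩ := hpow (k + 1)
  obtain ⟨e, he⟩ : ∃ e, e = (1 + x) * ((k + 1 : ℕ) + t * z) := ⟨_, rfl⟩
  have hw : (1 + x) * (1 + t) ^ (k + 1) = 1 + (x + t * e) := by rw [hz, he]; ring
  -- Terms with at least two factors t vanish: both t and x + te are multiples of x, so such a term
  -- is divisible by x^m·t², and t² = x²y·t.
  have hsplit : ∑ i ∈ Finset.range (m + 3), (x + t * e) ^ i * t ^ (m + 2 - i) =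
      (x + t * e) ^ (m + 2) + (x + t * e) ^ (m + 1) * t := by
    rw [Finset.sum_range_succ, Finset.sum_range_succ, show m + 2 - (m + 2) = 0 by omega,
      show m + 2 - (m + 1) = 1 by omega, Finset.sum_eq_zero]
    · ring
    · intro i hi
      have hi := Finset.mem_range.mp hi
      obtain ⟨l, rfl⟩ : ∃ l, m = i + l := ⟨m - i, by omega⟩
      rw [show i + l + 2 - i = l + 2 by omega]
      have h1 : x + t * e = x * (1 + x * y * e) := by rw [ht]; ring
      have h2 : t ^ (l + 2) = t * t * (x ^ l * (x * y) ^ l) := by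
        rw [← mul_pow, show x * (x * y) = t by rw [ht]; ring]; ring
      rw [h1, h2, mul_pow]
      linear_combination (1 + x * y * e) ^ i * y * (x * y) ^ l * hxy +
        x ^ i * (1 + x * y * e) ^ i * t * x ^ l * (x * y) ^ l * ht
  obtain ⟨z1, hz1⟩ := exists_add_mul_pow_eq (x := x) (y := y) (e := e) (m + 1)
  obtain ⟨z2, hz2⟩ := exists_add_mul_pow_eq (x := x) (y := y) (e := e) m
  rw [← ht] at hz1 hz2
  have hb : (x + t * e) ^ (m + 2) = x ^ (m + 2) + (m + 2) * (k + 1) * (x ^ (m + 1) * t) := by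
    rw [hz1, he]
    push_cast
    linear_combination (z1 + (m + 2) * (k + 1)) * hxy + (m + 2) * (1 + x) * z * htt
  have hc : (x + t * e) ^ (m + 1) * t = x ^ (m + 1) * t := by
    rw [hz2]
    linear_combination z2 * htt + (m + 1) * e * y * hxy
  have hxt : x ^ (m + 2) * t = 0 := hxy
  rw [hsum, hw, key, hsplit, hb, hc, hq' _ _ rfl, hz]
  push_cast at hpy ⊢
  linear_combination (↑k + 1 + t * z) * (hxt + (1 + (m + 2) * (k + 1)) * htt +
    (MvPolynomial.aeval ![x, 0]) q * hpy)

end GeomSum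

/-! ### Nakayama argument and the quadratic recursion -/

section Module

variable {R V : Type*} [CommRing R] [AddCommGroup V] [Module R V]

theorem exists_eq_sq_mul_of_smul_mem [FaithfulSMul R V] {x t : R} {b : V} (hx : IsNilpotent x)
    (ht : IsNilpotent t) (hspan : Submodule.span R {b} = ⊤)
    (htV : ∀ v : V, t • v ∈ Ideal.span {x, t} • Ideal.span {x, t} • (⊤ : Submodule R V)) :
    ∃ y, t = x ^ 2 * y := by
  set I : Ideal R := Ideal.span {x, t} with hI
  have hInil : I ≤ nilradical R := by
    rw [hI, Ideal.span_le]
    rintro z (rfl | rfl)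
    exacts [hx, ht]
  have htb := htV b
  rw [← Submodule.smul_assoc, ← hspan, Submodule.mem_smul_span_singleton] at htb
  obtain ⟨c, hc, hcb⟩ := htb
  -- Hence (1 - β)t = αx² on b with β in the nil ideal I, and 1 - β can be inverted.
  have hII : I • I ≤ Ideal.span {x ^ 2} ⊔ Ideal.span {t} * I := by
    rw [smul_eq_mul, Ideal.mul_le]
    intro u hu v hv
    obtain ⟨α, β, rfl⟩ := Ideal.mem_span_pair.mp hu
    obtain ⟨γ, δ, rfl⟩ := Ideal.mem_span_pair.mp hv
    rw [show (α * x + β * t) * (γ * x + δ * t) =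
      (α * γ) * x ^ 2 + t * ((α * δ + β * γ) * x + β * δ * t) by ring]
    refine Submodule.add_mem_sup (Ideal.mul_mem_left _ _ (Ideal.mem_span_singleton_self _))
      (Ideal.mul_mem_mul (Ideal.mem_span_singleton_self _) (Ideal.mem_span_pair.mpr ⟨_, _, rfl⟩))
  obtain ⟨u, hu, w, hw, rfl⟩ := Submodule.mem_sup.mp (hII hc)
  obtain ⟨α, rfl⟩ := Ideal.mem_span_singleton'.mp hu
  obtain ⟨β, hβ, rfl⟩ := Ideal.mem_span_singleton_mul.mp hw
  obtain ⟨ε, hε⟩ : IsUnit (1 - β) := IsNilpotent.isUnit_one_sub (hInil hβ)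
  refine ⟨α * (ε⁻¹ : Rˣ), ?_⟩
  apply FaithfulSMul.eq_of_smul_eq_smul (α := V)
  intro v
  obtain ⟨r, rfl⟩ := Submodule.mem_span_singleton.mp (hspan ▸ Submodule.mem_top : v ∈ _)
  have h1 : ((1 - β) * t) • b = (x ^ 2 * α) • b := by
    rw [sub_mul, sub_smul, one_mul, ← hcb, ← sub_smul]
    congr 1; ring
  rw [smul_comm t, smul_comm _ r]
  congr 1
  calc t • b = ((ε⁻¹ : Rˣ) : R) • ((1 - β) * t) • b := by
        rw [← mul_smul, ← mul_assoc, ← hε, Units.inv_mul, one_mul]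
    _ = _ := by rw [h1, ← mul_smul]; congr 1; ring

theorem eq_zero_of_coprime_nsmul {W : Type*} [AddCommGroup W] {v : W} {m n : ℕ}
    (h : m.Coprime n) (hm : m • v = 0) (hn : n • v = 0) : v = 0 := by
  rw [← AddMonoid.addOrderOf_eq_one_iff, ← Nat.dvd_one, ← h]
  exact Nat.dvd_gcd (addOrderOf_dvd_of_nsmul_eq_zero hm) (addOrderOf_dvd_of_nsmul_eq_zero hn)

theorem coprime_choose_two {p j : ℕ} (hp : p.Prime) (hj : 2 ≤ j) (hjp : j < p) :
    p.Coprime (j.choose 2) := by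
  rw [hp.coprime_iff_not_dvd]
  intro h
  have h2 : p ∣ j * (j - 1) := by
    rw [← Nat.div_mul_cancel (Nat.even_mul_pred_self j).two_dvd, ← Nat.choose_two_right]
    exact h.mul_right 2
  rcases hp.dvd_mul.mp h2 with h | h
  · exact absurd (Nat.le_of_dvd (by omega) h) (by omega)
  · exact absurd (Nat.le_of_dvd (by omega) h) (by omega)

theorem eq_zero_of_twisted_recursion {p : ℕ} (hp : p.Prime) (h5 : 5 ≤ p) {x y : R} {b P : V}
    {f : ℕ → V} (hx : IsNilpotent x) (hN : ∑ i ∈ Finset.range p, (1 + x) ^ i = 0)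
    (ht : (1 + x ^ 2 * y) ^ p = 1)
    (hN1 : ∑ i ∈ Finset.range p, ((1 + x) * (1 + x ^ 2 * y)) ^ i = 0)
    (hf : ∀ k, f (k + 1) = f k + P + ((1 + x ^ 2 * y) ^ k * ∑ j ∈ Finset.range p,
      (1 + x ^ 2 * y) ^ j * ∑ i ∈ Finset.range j, ((1 + x) * (1 + x ^ 2 * y) ^ k) ^ i) • b)
    (hf0 : f 0 = 0) (hf1 : f 1 = 0) {j : ℕ} (hj : 2 ≤ j) (hjp : j < p) (hfj : f j = 0) (k : ℕ) :
    f k = 0 ∧ ∑ i ∈ Finset.range p, ((1 + x) * (1 + x ^ 2 * y) ^ k) ^ i = 0 := by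
  have hpy := (natCast_mul_eq_zero_of_geomSum_eq_zero hp (by omega) hx hN ht).1
  obtain ⟨hxy, hNk⟩ := geomSum_mul_pow_eq_zero hp (by omega) hx hN ht hN1
  obtain ⟨κ, hκ⟩ := exists_twisted_geomSum_eq hp (by omega) hpy hxy
  refine ⟨?_, hNk k⟩
  set v : V := (x ^ (p - 3) * (x ^ 2 * y)) • b with hv
  have hpv : p • v = 0 := by
    rw [hv, ← Nat.cast_smul_eq_nsmul R, ← mul_smul, mul_left_comm, hpy, mul_zero, zero_smul]
  -- Summing the affine increments; f 1 = 0 then removes the linear part, leaving a multiple of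
  -- C(k,2)·v.
  have hform (k : ℕ) : f k = k • (P + κ • b) + ((p - 2) * (k + 1).choose 2) • v := by
    induction k with
    | zero => simp [hf0]
    | succ k ih =>
      rw [hf, ih, hκ, add_smul, mul_smul ((p - 2) * (k + 1) : R), ← hv,
        Nat.choose_succ_succ' (k + 1) 1,
        Nat.choose_one_right, show ((p : R) - 2) * (k + 1) = ((p - 2) * (k + 1) : ℕ) by
          rw [Nat.cast_mul, Nat.cast_sub (by omega)]; push_cast; ring, Nat.cast_smul_eq_nsmul]
      module
  have h1 := hform 1
  rw [hf1, one_smul] at h1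
  have hP : P + κ • b = - ((p - 2) • v) := by
    rw [eq_neg_iff_add_eq_zero, h1]; simp
  have hform' (k : ℕ) : f k = ((p - 2) * k.choose 2) • v := by
    rw [hform, hP, Nat.choose_succ_succ' k 1, Nat.choose_one_right]
    module
  have hj0 := hform' j
  rw [hfj] at hj0
  have hcop : ((p - 2) * j.choose 2).Coprime p := by
    refine Nat.Coprime.mul_left ?_ (coprime_choose_two hp hj hjp).symm
    rw [Nat.coprime_comm, hp.coprime_iff_not_dvd]
    exact fun h => absurd (Nat.le_of_dvd (by omega) h) (by omega)
  rw [hform', eq_zero_of_coprime_nsmul hcop hj0.symm hpv, smul_zero]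

end Module

/-! ### Powers in a group acting on an abelian normal subgroup -/

section Metabelian

variable {G R V : Type*} [Group G] [CommRing R] [AddCommGroup V] [Module R V]
  {e : Multiplicative V →* G} {ρ : G →* R}

open Multiplicative in
theorem ofAdd_mul_pow_eq (he : ∀ g v, g * e (ofAdd v) * g⁻¹ = e (ofAdd (ρ g • v))) (a : V) (g : G)
    (m : ℕ) :
    (e (ofAdd a) * g) ^ m = e (ofAdd ((∑ i ∈ Finset.range m, ρ g ^ i) • a)) * g ^ m := by
  induction m with
  | zero => simp
  | succ m ih =>
    rw [pow_succ, ih, Finset.sum_range_succ, add_smul, ofAdd_add, map_mul, ← map_pow, ← he]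
    group

-- Collecting every t to the left: conjugating t by g^j costs the j-th partial norm of g applied to
-- c.
open Multiplicative in
theorem mul_pow_eq_of_conj_eq (he : ∀ g v, g * e (ofAdd v) * g⁻¹ = e (ofAdd (ρ g • v)))
    {c : V} {g t : G} (hc : g * t * g⁻¹ = e (ofAdd c) * t) (m : ℕ) :
    (t * g) ^ m = e (ofAdd ((∑ j ∈ Finset.range m, ρ t ^ j * ∑ i ∈ Finset.range j, ρ g ^ i) • c)) *
      t ^ m * g ^ m := by
  have hconj (j : ℕ) :
      g ^ j * t * (g ^ j)⁻¹ = e (ofAdd ((∑ i ∈ Finset.range j, ρ g ^ i) • c)) * t := by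
    induction j with
    | zero => simp
    | succ j ih =>
      calc g ^ (j + 1) * t * (g ^ (j + 1))⁻¹ =
          g ^ j * (g * t * g⁻¹) * (g ^ j)⁻¹ := by group
        _ = (g ^ j * e (ofAdd c) * (g ^ j)⁻¹) * (g ^ j * t * (g ^ j)⁻¹) := by rw [hc]; group
        _ = _ := by
          rw [ih, he, map_pow, ← mul_assoc, ← map_mul, ← ofAdd_add, ← add_smul,
            Finset.sum_range_succ, add_comm]
  induction m with
  | zero => simp
  | succ m ih =>
    set d := e (ofAdd ((∑ j ∈ Finset.range m, ρ t ^ j * ∑ i ∈ Finset.range j, ρ g ^ i) • c))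
      with hd
    calc (t * g) ^ (m + 1) = d * (t ^ m * (g ^ m * t * (g ^ m)⁻¹) * g ^ (m + 1)) := by
          rw [pow_succ, ih]; group
      _ = d * (t ^ m * e (ofAdd ((∑ i ∈ Finset.range m, ρ g ^ i) • c)) * (t ^ m)⁻¹) *
            t ^ (m + 1) * g ^ (m + 1) := by
          rw [hconj]; group
      _ = _ := by
          rw [he, map_pow, hd, ← map_mul, ← ofAdd_add, ← mul_smul, ← add_smul,
            Finset.sum_range_succ]

-- With f k the module element of (t^k s)^p, the collection formula for t·(t^k s) is the recursion
-- of `eq_zero_of_twisted_recursion`.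
open Multiplicative in
theorem pow_eq_one_of_three [FaithfulSMul R V] (hinj : Function.Injective e)
    (he : ∀ g v, g * e (ofAdd v) * g⁻¹ = e (ofAdd (ρ g • v)))
    {p : ℕ} (hp : p.Prime) (h5 : 5 ≤ p) (hpow : ∀ g : G, g ^ p ∈ e.range) {s t : G} {b : V}
    (hb : s * t * s⁻¹ = e (ofAdd b) * t) {y : R} (hy : ρ t - 1 = (ρ s - 1) ^ 2 * y)
    (hnil : IsNilpotent (ρ s - 1)) {j : ℕ} (hj : 2 ≤ j) (hjp : j < p)
    (h0 : ∀ a ∈ e.range, (a * s) ^ p = 1) (h1 : ∀ a ∈ e.range, (a * (t * s)) ^ p = 1)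
    (h2 : (t ^ j * s) ^ p = 1) (k : ℕ) (a : G) (ha : a ∈ e.range) : (a * (t ^ k * s)) ^ p = 1 := by
  have hnorm (g : G) (h : ∀ a ∈ e.range, (a * g) ^ p = 1) :
      ∑ i ∈ Finset.range p, ρ g ^ i = 0 := by
    apply FaithfulSMul.eq_of_smul_eq_smul (α := V)
    intro v
    have h1 := h _ ⟨ofAdd v, rfl⟩
    have h2 := h _ e.range.one_mem
    rw [one_mul] at h2
    rw [ofAdd_mul_pow_eq he, h2, mul_one, ← map_one e] at h1
    simpa using hinj h1
  have hρe (v : V) : ρ (e (ofAdd v)) = 1 := by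
    apply FaithfulSMul.eq_of_smul_eq_smul (α := V)
    intro w
    rw [one_smul, ← ofAdd.injective.eq_iff, ← hinj.eq_iff, ← he, ← map_mul, mul_comm, map_mul,
      mul_inv_cancel_right]
  have hσ : ρ s = 1 + (ρ s - 1) := by ring
  have hτ : ρ t = 1 + (ρ s - 1) ^ 2 * y := by rw [← hy]; ring
  choose f hf using fun k => hpow (t ^ k * s)
  obtain ⟨P, hP⟩ := hpow t
  -- t^p lies in the range of e, which is abelian and so acts trivially on itself.
  have hτp : ρ t ^ p = 1 := by
    rw [← map_pow, ← hP]; exact hρe P.toAdd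
  have hone (v : Multiplicative V) (hv : e v = 1) : v.toAdd = 0 := by
    rw [← map_one e] at hv
    rw [hinj hv]; rfl
  have hrec := eq_zero_of_twisted_recursion (p := p) (x := ρ s - 1) (y := y) (b := b)
    (P := P.toAdd) (f := fun k => (f k).toAdd) hp h5 hnil
    (by rw [← hσ]; exact hnorm s h0) (by rw [← hτ, hτp])
    (by rw [← hσ, ← hτ, mul_comm, ← map_mul]; exact hnorm _ h1)
    (fun k => by
      have hc : (t ^ k * s) * t * (t ^ k * s)⁻¹ = e (ofAdd (ρ t ^ k • b)) * t := by
        rw [← map_pow, ← he]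
        calc _ = t ^ k * (s * t * s⁻¹) * (t ^ k)⁻¹ := by group
          _ = _ := by rw [hb]; group
      have h := mul_pow_eq_of_conj_eq he hc p
      rw [← mul_assoc, ← pow_succ', ← hf, ← hP, ← hf, ← map_mul, ← map_mul] at h
      rw [hinj h, ← hσ, ← hτ]
      simp only [toAdd_mul, toAdd_ofAdd, map_mul, map_pow, ← mul_smul]
      rw [add_comm, add_comm _ P.toAdd, ← add_assoc, add_comm _ P.toAdd]
      congr 2
      rw [mul_comm]
      simp only [mul_comm (ρ s)])
    (hone _ (by rw [hf, pow_zero, h0 1 e.range.one_mem]))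
    (hone _ (by rw [hf, pow_one, ← one_mul (t * s), h1 1 e.range.one_mem])) hj hjp
    (hone _ (by rw [hf, h2])) k
  obtain ⟨v, rfl⟩ := ha
  have h3 : f k = 1 := hrec.1
  have h4 := hrec.2
  rw [← hσ, ← hτ, mul_comm, ← map_pow, ← map_mul] at h4
  have h5 := ofAdd_mul_pow_eq he v.toAdd (t ^ k * s) p
  rw [h4, zero_smul, ← hf, h3, ofAdd_zero, map_one, mul_one] at h5
  exact h5

end Metabelian

/-! ### Collection in a normal subgroup of class at most two -/

section ClassTwo

open scoped commutatorElement

variable {G : Type*} [Group G] {H : Subgroup G}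

/-- In a group whose commutators commute with `H`, products of powers collect. -/
theorem pow_mul_pow_eq_of_commute (hH : ∀ c ∈ ⁅H, H⁆, ∀ h ∈ H, Commute c h) {q a : G} (hq : q ∈ H)
    (ha : a ∈ H) (i : ℕ) : q ^ i * a ^ i = (q * a) ^ i * ⁅q, a⁆ ^ i.choose 2 := by
  have hd : ⁅q, a⁆ ∈ ⁅H, H⁆ := Subgroup.commutator_mem_commutator hq ha
  set d := ⁅q, a⁆ with hd'
  have hqa : q * a = d * (a * q) := by rw [hd', commutatorElement_def]; group
  have hda := hH d hd a ha
  have hdq := hH d hd q hq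
  have hswap (i : ℕ) : q ^ i * a = d ^ i * (a * q ^ i) := by
    induction i with
    | zero => simp
    | succ i ih =>
      rw [pow_succ', mul_assoc, ih, ← mul_assoc, ← (hdq.pow_left i).eq, mul_assoc, ← mul_assoc q,
        hqa, pow_succ d]
      simp only [mul_assoc]
  induction i with
  | zero => simp
  | succ i ih =>
    calc q ^ (i + 1) * a ^ (i + 1) = q * (q ^ i * a) * a ^ i := by
          rw [pow_succ', pow_succ' a]; simp only [mul_assoc]
      _ = d ^ i * (q * a) * (q ^ i * a ^ i) := by
          rw [hswap, ← mul_assoc, ← (hdq.pow_left i).eq]; simp only [mul_assoc]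
      _ = (q * a) ^ (i + 1) * d ^ (i + 1).choose 2 := by
          rw [ih, Nat.choose_succ_succ' i 1, Nat.choose_one_right, pow_add d,
            ((hdq.mul_right hda).pow_left i).eq, pow_succ' (q * a), mul_assoc,
            ← mul_assoc (d ^ i), (((hdq.mul_right hda).pow_left i).pow_right i).eq]
          simp only [mul_assoc]

/-- The point is that q and c do not depend on i. Moving s^m past t^i yields the i-th power of a
conjugate a of t, and q^i a^i is (qa)^i up to the C(i,2)-th power of a commutator. -/
theorem exists_mul_pow_eq_of_commute [H.Normal] (hH : ∀ c ∈ ⁅H, H⁆, ∀ h ∈ H, Commute c h)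
    {t : G} (ht : t ∈ H) (s : G) (m : ℕ) :
    ∃ q ∈ H, ∃ c ∈ ⁅H, H⁆, ∀ i : ℕ, (t ^ i * s) ^ m = q ^ i * c ^ i.choose 2 * s ^ m := by
  induction m with
  | zero => exact ⟨1, H.one_mem, 1, Subgroup.one_mem _, by simp⟩
  | succ m ih =>
    obtain ⟨q, hq, c, hc, h⟩ := ih
    have ha : s ^ m * t * (s ^ m)⁻¹ ∈ H := ‹H.Normal›.conj_mem _ ht _
    set a := s ^ m * t * (s ^ m)⁻¹ with ha'
    have hd : ⁅q, a⁆ ∈ ⁅H, H⁆ := Subgroup.commutator_mem_commutator hq ha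
    refine ⟨q * a, mul_mem hq ha, ⁅q, a⁆ * c, mul_mem hd hc, fun i => ?_⟩
    have hai : s ^ m * t ^ i = a ^ i * s ^ m := by rw [ha', conj_pow]; group
    have hdc : Commute ⁅q, a⁆ c := hH _ hd _ (Subgroup.commutator_le_self H hc)
    calc (t ^ i * s) ^ (m + 1) = q ^ i * c ^ i.choose 2 * (s ^ m * t ^ i) * s := by
          rw [pow_succ, h]; simp only [mul_assoc]
      _ = q ^ i * a ^ i * c ^ i.choose 2 * s ^ (m + 1) := by
          rw [hai, mul_assoc (q ^ i), ← mul_assoc (c ^ _),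
            ((hH c hc a ha).pow_pow (i.choose 2) i).eq, pow_succ]
          simp only [mul_assoc]
      _ = _ := by
          rw [pow_mul_pow_eq_of_commute hH hq ha, hdc.mul_pow]
          simp only [mul_assoc]

theorem mul_pow_eq_one_of_commute_commutator [H.Normal]
    (hH : ∀ c ∈ ⁅H, H⁆, ∀ h ∈ H, Commute c h) {p : ℕ} (hp : p.Prime) (hG : IsPGroup p G)
    {s t : G} (ht : t ∈ H) {j : ℕ} (hj : 2 ≤ j) (hjp : j < p) (h0 : s ^ p = 1)
    (h1 : (t * s) ^ p = 1) (h2 : (t ^ j * s) ^ p = 1) (i : ℕ) : (t ^ i * s) ^ p = 1 := by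
  obtain ⟨q, -, c, -, h⟩ := exists_mul_pow_eq_of_commute hH ht s p
  have hq := h 1
  rw [pow_one, h1, h0] at hq
  simp only [pow_one, Nat.choose_succ_self, pow_zero, mul_one] at hq
  have hc := h j
  rw [h2, ← hq, h0] at hc
  simp only [one_pow, one_mul, mul_one] at hc
  have hc1 : c = 1 := by
    rw [← orderOf_eq_one_iff, ← Nat.dvd_one,
      ← (hG.orderOf_coprime (coprime_choose_two hp hj hjp) c).gcd_eq_one]
    exact Nat.dvd_gcd dvd_rfl (orderOf_dvd_of_pow_eq_one hc.symm)
  rw [h, ← hq, hc1, h0]; simp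

theorem mul_pow_eq_one_of_isMulCommutative [H.Normal] [IsMulCommutative H] {p : ℕ}
    {s t : G} (ht : t ∈ H) (h0 : s ^ p = 1) (h1 : (t * s) ^ p = 1) (i : ℕ) :
    (t ^ i * s) ^ p = 1 := by
  have hbot : ⁅H, H⁆ = ⊥ := Subgroup.commutator_self_eq_bot_iff.mpr ‹_›
  obtain ⟨q, -, c, hc, h⟩ := exists_mul_pow_eq_of_commute
    (fun c hc h _ => by rw [hbot, Subgroup.mem_bot] at hc; rw [hc]; exact Commute.one_left h)
    ht s p
  rw [hbot, Subgroup.mem_bot] at hc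
  have hq := h 1
  rw [pow_one, h1, h0, hc] at hq
  simp only [pow_one, one_pow, mul_one] at hq
  rw [h, ← hq, hc, h0]; simp

end ClassTwo

/-! ### Maximal subgroups when the Frattini subgroup has index p² -/

section Counting

variable {G : Type*} [Group G] {p : ℕ}

theorem isCoatom_of_index_eq_prime (hp : p.Prime) {M : Subgroup G} (hM : M.index = p) :
    IsCoatom M := by
  refine ⟨fun h => hp.ne_one (by rw [← hM, h, Subgroup.index_top]), fun K hK => ?_⟩
  rcases (Nat.dvd_prime hp).mp (hM ▸ Subgroup.index_dvd_of_le hK.le) with h | h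
  · exact Subgroup.index_eq_one.mp h
  · have h1 := Subgroup.relIndex_mul_index hK.le
    rw [h, hM, Nat.mul_eq_right hp.ne_zero] at h1
    exact absurd (Subgroup.relIndex_eq_one.mp h1) hK.not_ge

theorem mul_pow_eq_one_of_mem_maximalBranch {M : Subgroup G} (hM : IsCoatom M)
    (hB : ∀ x ∈ maximalBranch M, orderOf x = p) {g : G} (hg : g ∈ M) (hgΦ : g ∉ frattini G)
    {a : G} (ha : a ∈ frattini G) : (a * g) ^ p = 1 := by
  rw [← hB (a * g) ⟨mul_mem (frattini_le_coatom hM ha) hg,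
    fun h => hgΦ (((frattini G).mul_mem_cancel_left ha).mp h)⟩]
  exact pow_orderOf_eq_one _

variable [Finite G]

theorem IsPGroup.index_eq_of_isCoatom [Fact p.Prime] (hG : IsPGroup p G) {M : Subgroup G}
    (hM : IsCoatom M) : M.index = p := by
  obtain ⟨n, hn⟩ := IsPGroup.iff_card.mp hG
  obtain ⟨m, hm⟩ := IsPGroup.iff_card.mp (hG.to_subgroup M)
  have hp := Fact.out (p := p.Prime)
  have hlt : m < n := by
    by_contra hle
    refine hM.1 (Subgroup.eq_top_of_le_card M ?_)
    rw [hm, hn]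
    exact Nat.pow_le_pow_right hp.pos (not_lt.mp hle)
  obtain ⟨K, hK, hMK⟩ := Sylow.exists_subgroup_card_pow_succ (p := p) (n := m) (H := M)
    (hn ▸ pow_dvd_pow p hlt) hm
  have hKtop : K = ⊤ := by
    refine hM.2 K (lt_of_le_of_ne hMK ?_)
    rintro rfl
    rw [hm] at hK
    exact absurd (Nat.pow_right_injective hp.two_le hK) (by omega)
  have := M.index_mul_card
  rw [hm, ← Subgroup.card_top (G := G), ← hKtop, hK, pow_succ'] at this
  exact Nat.eq_of_mul_eq_mul_right (pow_pos hp.pos m) this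

theorem IsPGroup.normal_of_isCoatom [Fact p.Prime] (hG : IsPGroup p G) {M : Subgroup G}
    (hM : IsCoatom M) : M.Normal :=
  Subgroup.NormalizerCondition.normal_of_coatom M
    (@Group.normalizerCondition_of_isNilpotent G _ hG.isNilpotent) hM

theorem IsPGroup.pow_mem_frattini [Fact p.Prime] (hG : IsPGroup p G) (x : G) :
    x ^ p ∈ frattini G := by
  simp only [frattini, Order.radical, Subgroup.mem_iInf]
  intro M hM
  have := hG.normal_of_isCoatom hM
  rw [← hG.index_eq_of_isCoatom hM]
  exact M.pow_index_mem x

theorem IsPGroup.commutator_le_frattini [Fact p.Prime] (hG : IsPGroup p G) :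
    commutator G ≤ frattini G := by
  simp only [frattini, Order.radical, le_iInf_iff]
  intro M hM
  have := hG.normal_of_isCoatom hM
  rw [← Subgroup.Normal.quotient_commutative_iff_commutator_le]
  have hc : Nat.card (G ⧸ M) = p := hG.index_eq_of_isCoatom hM
  have := isCyclic_of_prime_card hc
  infer_instance

section

variable [Fact p.Prime] (hG : IsPGroup p G) (hΦ : (frattini G).index = p ^ 2)

include hG hΦ

/-- Index 1 would make g generate G, hence G/Φ(G) cyclic of order p², although its exponent divides
p. -/
theorem isCoatom_frattini_sup_zpowers {g : G} (hg : g ∉ frattini G) :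
    IsCoatom (frattini G ⊔ Subgroup.zpowers g) := by
  have hp := Fact.out (p := p.Prime)
  refine isCoatom_of_index_eq_prime hp ?_
  set K := frattini G ⊔ Subgroup.zpowers g with hK
  have hle : frattini G ≤ K := le_sup_left
  have hgK : g ∈ K := (le_sup_right : Subgroup.zpowers g ≤ K) (Subgroup.mem_zpowers g)
  obtain ⟨i, hi, h⟩ := (Nat.dvd_prime_pow hp).mp (hΦ ▸ Subgroup.index_dvd_of_le hle)
  interval_cases i
  · exfalso
    have htop : Subgroup.zpowers g = ⊤ := by
      refine frattini_nongenerating ?_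
      rw [sup_comm, ← hK]
      exact Subgroup.index_eq_one.mp h
    have hcard := orderOf_eq_card_of_forall_mem_zpowers (g := (g : G ⧸ frattini G)) (fun x => by
      obtain ⟨x, rfl⟩ := QuotientGroup.mk_surjective x
      obtain ⟨k, rfl⟩ := Subgroup.mem_zpowers_iff.mp (htop ▸ Subgroup.mem_top x)
      exact ⟨k, rfl⟩)
    rw [← Subgroup.index_eq_card, hΦ] at hcard
    have : orderOf (g : G ⧸ frattini G) ∣ p := orderOf_dvd_of_pow_eq_one
      ((QuotientGroup.eq_one_iff _).mpr (hG.pow_mem_frattini g))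
    rw [hcard] at this
    have := Nat.le_of_dvd hp.pos this
    nlinarith [hp.two_le]
  · simpa using h
  · exfalso
    have h1 := Subgroup.relIndex_mul_index hle
    rw [h, hΦ, Nat.mul_eq_right (pow_ne_zero 2 hp.ne_zero)] at h1
    exact hg (Subgroup.relIndex_eq_one.mp h1 hgK)

theorem IsCoatom.eq_frattini_sup_zpowers {M : Subgroup G} (hM : IsCoatom M) {g : G}
    (hgM : g ∈ M) (hg : g ∉ frattini G) : M = frattini G ⊔ Subgroup.zpowers g := by
  have hle : frattini G ⊔ Subgroup.zpowers g ≤ M :=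
    sup_le (frattini_le_coatom hM) (by rwa [Subgroup.zpowers_le])
  by_contra hne
  exact hM.1 ((isCoatom_frattini_sup_zpowers hG hΦ hg).2 M (lt_of_le_of_ne hle (Ne.symm hne)))

theorem IsCoatom.eq_of_mem {M N : Subgroup G} (hM : IsCoatom M) (hN : IsCoatom N) {g : G}
    (hgM : g ∈ M) (hgN : g ∈ N) (hg : g ∉ frattini G) : M = N :=
  (hM.eq_frattini_sup_zpowers hG hΦ hgM hg).trans (hN.eq_frattini_sup_zpowers hG hΦ hgN hg).symm

theorem IsCoatom.exists_notMem_frattini {M : Subgroup G} (hM : IsCoatom M) :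
    ∃ g ∈ M, g ∉ frattini G := by
  by_contra! h
  have hp := Fact.out (p := p.Prime)
  have := hG.index_eq_of_isCoatom hM
  rw [le_antisymm h (frattini_le_coatom hM), hΦ] at this
  nlinarith [hp.two_le]

variable {H : Subgroup G} (hH : IsCoatom H)

include hH

theorem IsCoatom.orderOf_mk_eq {M : Subgroup G} [M.Normal] (hM : IsCoatom M) (hMH : M ≠ H) {t : G}
    (ht : t ∈ H) (htΦ : t ∉ frattini G) : orderOf (t : G ⧸ M) = p := by
  refine orderOf_eq_prime ?_ ?_
  · exact (QuotientGroup.eq_one_iff _).mpr (frattini_le_coatom hM (hG.pow_mem_frattini t))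
  · rw [ne_eq, QuotientGroup.eq_one_iff]
    exact fun h => hMH (hM.eq_of_mem hG hΦ hH h ht htΦ)

theorem IsCoatom.exists_pow_mul_mem {M : Subgroup G} (hM : IsCoatom M) (hMH : M ≠ H) (s : G)
    {t : G} (ht : t ∈ H) (htΦ : t ∉ frattini G) : ∃ i < p, t ^ i * s ∈ M := by
  have hp := Fact.out (p := p.Prime)
  have := hG.normal_of_isCoatom hM
  have ho := hH.orderOf_mk_eq hG hΦ hM hMH ht htΦ
  have hne : (t : G ⧸ M) ≠ 1 := fun h => hp.ne_one (by rw [← ho, h, orderOf_one])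
  obtain ⟨k, hk⟩ := mem_powers_of_prime_card (p := p) (g' := (s : G ⧸ M)⁻¹)
    (hG.index_eq_of_isCoatom hM) hne
  refine ⟨k % p, Nat.mod_lt _ hp.pos, ?_⟩
  rw [← QuotientGroup.eq_one_iff, QuotientGroup.mk_mul, QuotientGroup.mk_pow, ← ho,
    pow_mod_orderOf, ← eq_inv_iff_mul_eq_one]
  exact hk

theorem IsCoatom.eq_of_pow_mul_mem {M : Subgroup G} (hM : IsCoatom M) (hMH : M ≠ H) {s t : G}
    (ht : t ∈ H) (htΦ : t ∉ frattini G) {i j : ℕ} (hi : i < p) (hj : j < p)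
    (hiM : t ^ i * s ∈ M) (hjM : t ^ j * s ∈ M) : i = j := by
  have := hG.normal_of_isCoatom hM
  have ho := hH.orderOf_mk_eq hG hΦ hM hMH ht htΦ
  rw [← QuotientGroup.eq_one_iff, QuotientGroup.mk_mul, QuotientGroup.mk_pow] at hiM hjM
  refine pow_injOn_Iio_orderOf (ho ▸ hi) (ho ▸ hj) ?_
  exact mul_right_cancel (hiM.trans hjM.symm)

theorem ncard_isCoatom_ne : {M : Subgroup G | IsCoatom M ∧ M ≠ H}.ncard = p := by
  obtain ⟨t, ht, htΦ⟩ := hH.exists_notMem_frattini hG hΦ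
  obtain ⟨s, hs⟩ : ∃ s, s ∉ H := by
    by_contra! h
    exact hH.1 (eq_top_iff.mpr fun x _ => h x)
  have hsH (i : ℕ) : t ^ i * s ∉ H := fun h => hs ((H.mul_mem_cancel_left (H.pow_mem ht i)).mp h)
  have hsΦ (i : ℕ) : t ^ i * s ∉ frattini G := fun h => hsH i (frattini_le_coatom hH h)
  have hmem (i : ℕ) : t ^ i * s ∈ frattini G ⊔ Subgroup.zpowers (t ^ i * s) :=
    (le_sup_right : Subgroup.zpowers _ ≤ _) (Subgroup.mem_zpowers _)
  have hco (i : ℕ) := isCoatom_frattini_sup_zpowers hG hΦ (hsΦ i)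
  have hne (i : ℕ) : frattini G ⊔ Subgroup.zpowers (t ^ i * s) ≠ H := fun h => hsH i (h ▸ hmem i)
  have himage : {M : Subgroup G | IsCoatom M ∧ M ≠ H} =
      (fun i => frattini G ⊔ Subgroup.zpowers (t ^ i * s)) '' Set.Iio p := by
    ext M
    constructor
    · rintro ⟨hM, hMH⟩
      obtain ⟨i, hi, hiM⟩ := hH.exists_pow_mul_mem hG hΦ hM hMH s ht htΦ
      exact ⟨i, hi, (hM.eq_frattini_sup_zpowers hG hΦ hiM (hsΦ i)).symm⟩
    · rintro ⟨i, -, rfl⟩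
      exact ⟨hco i, hne i⟩
  rw [himage, Set.InjOn.ncard_image]
  · rw [Set.ncard_eq_toFinset_card']; simp
  · intro i hi j hj hij
    refine hH.eq_of_pow_mul_mem hG hΦ (hco i) (hne i) ht htΦ hi hj (hmem i) ?_
    have := hmem j
    rwa [← show frattini G ⊔ Subgroup.zpowers (t ^ i * s) =
      frattini G ⊔ Subgroup.zpowers (t ^ j * s) from hij] at this

theorem orderOf_eq_of_forall_pow_eq_one {s t : G} (hs : s ∉ H) (ht : t ∈ H)
    (htΦ : t ∉ frattini G) (h : ∀ k, ∀ a ∈ frattini G, (a * (t ^ k * s)) ^ p = 1)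
    {M : Subgroup G} (hM : IsCoatom M) (hMH : M ≠ H) {x : G} (hx : x ∈ maximalBranch M) :
    orderOf x = p := by
  obtain ⟨hxM, hxΦ⟩ := hx
  refine orderOf_eq_prime ?_ (fun h1 => hxΦ (h1 ▸ (frattini G).one_mem))
  obtain ⟨k, -, hk⟩ := hH.exists_pow_mul_mem hG hΦ hM hMH s ht htΦ
  have hkΦ : t ^ k * s ∉ frattini G := fun h =>
    hs ((H.mul_mem_cancel_left (H.pow_mem ht k)).mp (frattini_le_coatom hH h))
  rw [hM.eq_frattini_sup_zpowers hG hΦ hxM hxΦ] at hk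
  obtain ⟨a, ha, z, hz, hg⟩ := Subgroup.mem_sup_of_normal_left.mp hk
  obtain ⟨l, rfl⟩ := mem_powers_iff_mem_zpowers.mpr hz
  simp only at hg
  have hl : ¬ p ∣ l := by
    rintro ⟨m, rfl⟩
    refine hkΦ (hg ▸ mul_mem ha ?_)
    rw [pow_mul]
    exact pow_mem (hG.pow_mem_frattini x) m
  have hxl : (x ^ l) ^ p = 1 := by
    rw [← h k a⁻¹ (inv_mem ha), ← hg, inv_mul_cancel_left]
  -- The order of x^p divides l, which is prime to p, and is also a power of p.
  rw [← orderOf_eq_one_iff, ← Nat.dvd_one, ← (hG.orderOf_coprime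
    ((Nat.Prime.coprime_iff_not_dvd Fact.out).mpr hl) (x ^ p)).gcd_eq_one]
  refine Nat.dvd_gcd dvd_rfl (orderOf_dvd_of_pow_eq_one ?_)
  rw [← pow_mul, mul_comm, pow_mul, hxl]

theorem ncard_eq_of_forall_pow_eq_one {s t : G} (hs : s ∉ H) (ht : t ∈ H)
    (htΦ : t ∉ frattini G) (h : ∀ k, ∀ a ∈ frattini G, (a * (t ^ k * s)) ^ p = 1) :
    {M : Subgroup G | IsCoatom M ∧ M ≠ H ∧ ∀ x ∈ maximalBranch M, orderOf x = p}.ncard = p := by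
  refine Eq.trans ?_ (ncard_isCoatom_ne hG hΦ hH)
  congr 1
  ext M
  exact ⟨fun h1 => ⟨h1.1, h1.2.1⟩, fun h1 => ⟨h1.1, h1.2, fun x hx =>
    orderOf_eq_of_forall_pow_eq_one hG hΦ hH hs ht htΦ h h1.1 h1.2 hx⟩⟩

theorem ncard_le_prime :
    {M : Subgroup G | IsCoatom M ∧ M ≠ H ∧ ∀ x ∈ maximalBranch M, orderOf x = p}.ncard ≤ p := by
  rw [← ncard_isCoatom_ne hG hΦ hH]
  exact Set.ncard_le_ncard (fun M h1 => ⟨h1.1, h1.2.1⟩) (Set.toFinite _)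

/-- Two maximal subgroups whose branches have exponent `p` contain suitable `s` and `t * s`. -/
theorem exists_of_two_isCoatom {M₁ M₂ : Subgroup G} (h₁ : IsCoatom M₁) (h₁H : M₁ ≠ H)
    (h₂ : IsCoatom M₂) (h₂H : M₂ ≠ H) (hne : M₁ ≠ M₂) :
    ∃ s ∉ H, ∃ t ∈ H, t ∉ frattini G ∧ s ∈ M₁ ∧ t * s ∈ M₂ := by
  obtain ⟨s, hs, hsΦ⟩ := h₁.exists_notMem_frattini hG hΦ
  obtain ⟨t, ht, htΦ⟩ := hH.exists_notMem_frattini hG hΦ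
  obtain ⟨i, hi, hiM⟩ := hH.exists_pow_mul_mem hG hΦ h₂ h₂H s ht htΦ
  have hsH : s ∉ H := fun h => h₁H (h₁.eq_of_mem hG hΦ hH hs h hsΦ)
  -- Taking t^i as the new t normalizes the second subgroup to exponent 1; t^i ∈ Φ(G) would put s in
  -- both subgroups.
  refine ⟨s, hsH, t ^ i, H.pow_mem ht i, fun h => ?_, hs, hiM⟩
  have hs2 : s ∈ M₂ := (M₂.mul_mem_cancel_left (frattini_le_coatom h₂ h)).mp hiM
  exact hne (h₁.eq_of_mem hG hΦ h₂ hs hs2 hsΦ)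

theorem ncard_eq_of_two
    (K : ∀ s ∉ H, ∀ t ∈ H, (∀ a ∈ frattini G, (a * s) ^ p = 1) →
      (∀ a ∈ frattini G, (a * (t * s)) ^ p = 1) →
      ∀ k, ∀ a ∈ frattini G, (a * (t ^ k * s)) ^ p = 1)
    {N : ℕ} (hN : {M : Subgroup G | IsCoatom M ∧ M ≠ H ∧
      ∀ x ∈ maximalBranch M, orderOf x = p}.ncard = N) : N = 0 ∨ N = 1 ∨ N = p := by
  by_cases h2 : N ≤ 1
  · omega
  obtain ⟨M₁, ⟨h₁, h₁H, hB₁⟩, M₂, ⟨h₂, h₂H, hB₂⟩, hne⟩ :=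
    (Set.one_lt_ncard (Set.toFinite _)).mp (hN ▸ not_le.mp h2)
  obtain ⟨s, hs, t, ht, htΦ, hs1, hs2⟩ := exists_of_two_isCoatom hG hΦ hH h₁ h₁H h₂ h₂H hne
  have hΦs (k : ℕ) : t ^ k * s ∉ frattini G := fun h =>
    hs ((H.mul_mem_cancel_left (H.pow_mem ht k)).mp (frattini_le_coatom hH h))
  right; right
  rw [← hN]
  refine ncard_eq_of_forall_pow_eq_one hG hΦ hH hs ht htΦ (K s hs t ht
    (fun a ha => mul_pow_eq_one_of_mem_maximalBranch h₁ hB₁ hs1 (by simpa using hΦs 0) ha)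
    (fun a ha => mul_pow_eq_one_of_mem_maximalBranch h₂ hB₂ hs2 (by simpa using hΦs 1) ha))

theorem ncard_eq_of_three
    (K : ∀ s ∉ H, ∀ t ∈ H, t ∉ frattini G → ∀ j, 2 ≤ j → j < p →
      (∀ a ∈ frattini G, (a * s) ^ p = 1) → (∀ a ∈ frattini G, (a * (t * s)) ^ p = 1) →
      (∀ a ∈ frattini G, (a * (t ^ j * s)) ^ p = 1) →
      ∀ k, ∀ a ∈ frattini G, (a * (t ^ k * s)) ^ p = 1)
    {N : ℕ} (hN : {M : Subgroup G | IsCoatom M ∧ M ≠ H ∧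
      ∀ x ∈ maximalBranch M, orderOf x = p}.ncard = N) : N = 0 ∨ N = 1 ∨ N = 2 ∨ N = p := by
  by_cases h2 : N ≤ 2
  · omega
  obtain ⟨M₁, ⟨h₁, h₁H, hB₁⟩, M₂, ⟨h₂, h₂H, hB₂⟩, M₃, ⟨h₃, h₃H, hB₃⟩, h12, h13, h23⟩ :=
    (Set.two_lt_ncard (Set.toFinite _)).mp (hN ▸ not_le.mp h2)
  obtain ⟨s, hs, t, ht, htΦ, hs1, hs2⟩ := exists_of_two_isCoatom hG hΦ hH h₁ h₁H h₂ h₂H h12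
  have hΦs (k : ℕ) : t ^ k * s ∉ frattini G := fun h =>
    hs ((H.mul_mem_cancel_left (H.pow_mem ht k)).mp (frattini_le_coatom hH h))
  obtain ⟨j, hjp, hs3⟩ := hH.exists_pow_mul_mem hG hΦ h₃ h₃H s ht htΦ
  have hj : 2 ≤ j := by
    by_contra hlt
    interval_cases j
    · exact h13 (h₁.eq_of_mem hG hΦ h₃ (by simpa using hs1) hs3 (hΦs 0))
    · exact h23 (h₂.eq_of_mem hG hΦ h₃ (by simpa using hs2) hs3 (hΦs 1))
  right; right; right
  rw [← hN]
  refine ncard_eq_of_forall_pow_eq_one hG hΦ hH hs ht htΦ (K s hs t ht htΦ j hj hjp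
    (fun a ha => mul_pow_eq_one_of_mem_maximalBranch h₁ hB₁ hs1 (by simpa using hΦs 0) ha)
    (fun a ha => mul_pow_eq_one_of_mem_maximalBranch h₂ hB₂ hs2 (by simpa using hΦs 1) ha)
    (fun a ha => mul_pow_eq_one_of_mem_maximalBranch h₃ hB₃ hs3 (hΦs j) ha))

end

end Counting

/-! ### Structure of groups of maximal class -/

section MaximalClass

open scoped commutatorElement

variable {G : Type*} [Group G] {p n : ℕ}

theorem mem_gOne_iff {g : G} : g ∈ gOne G ↔
    ∀ a ∈ (⊤ : Subgroup G).lowerCentralSeries 1, ⁅a, g⁆ ∈ (⊤ : Subgroup G).lowerCentralSeries 3 := by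
  rw [gOne, Subgroup.mem_comap, Subgroup.mem_centralizer_iff]
  constructor
  · intro h a ha
    rw [← commutatorElement_inv, inv_mem_iff, ← QuotientGroup.eq_one_iff,
      ← QuotientGroup.mk'_apply, map_commutatorElement, commutatorElement_eq_one_iff_mul_comm]
    exact (h _ ⟨a, ha, rfl⟩).symm
  · rintro h _ ⟨a, ha, rfl⟩
    rw [← commutatorElement_eq_one_iff_mul_comm, ← map_commutatorElement]
    exact (QuotientGroup.eq_one_iff _).mpr (h a ha)

namespace IsMaximalClass

variable (hG : IsMaximalClass p n G)

include hG

theorem isPGroup : IsPGroup p G := IsPGroup.of_card hG.card_eq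

theorem lowerCentralSeries_eq_bot_iff {k : ℕ} :
    (⊤ : Subgroup G).lowerCentralSeries k = ⊥ ↔ n - 1 ≤ k := by
  have := hG.isNilpotent
  rw [Subgroup.lowerCentralSeries_eq_bot_iff_nilpotencyClass_le, hG.nilpotencyClass_eq]

theorem lowerCentralSeries_succ_lt {k : ℕ} (hk : k < n - 1) :
    (⊤ : Subgroup G).lowerCentralSeries (k + 1) < (⊤ : Subgroup G).lowerCentralSeries k := by
  refine lt_of_le_of_ne (Subgroup.lowerCentralSeries_antitone _ (Nat.le_succ k)) fun h => ?_
  have hconst (m : ℕ) : (⊤ : Subgroup G).lowerCentralSeries (k + m) =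
      (⊤ : Subgroup G).lowerCentralSeries k := by
    induction m with
    | zero => rfl
    | succ m ih => rw [← add_assoc, Subgroup.lowerCentralSeries_succ, ih, ← Subgroup.lowerCentralSeries_succ, h]
  have h1 := hconst (n - 1)
  rw [hG.lowerCentralSeries_eq_bot_iff.mpr (by omega), eq_comm,
    hG.lowerCentralSeries_eq_bot_iff] at h1
  omega

theorem finite [Fact p.Prime] : Finite G :=
  Nat.finite_of_card_ne_zero (hG.card_eq ▸ pow_ne_zero n (Fact.out (p := p.Prime)).ne_zero)

variable [Fact p.Prime] (hn : 4 ≤ n)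

include hn

/-- Otherwise G is cyclic, hence of class at most 1, whereas n - 1 ≥ 3. -/
theorem two_le_of_index_frattini_eq {k : ℕ} (hk : (frattini G).index = p ^ k) : 2 ≤ k := by
  have := hG.finite
  by_contra hlt
  suffices h : ∃ g : G, Subgroup.zpowers g = ⊤ by
    obtain ⟨g, hg⟩ := h
    have hcomm : IsMulCommutative G :=
      (isCyclic_iff_exists_zpowers_eq_top.mpr ⟨g, hg⟩ : IsCyclic G).isMulCommutative
    have := (hG.lowerCentralSeries_eq_bot_iff (k := 1)).mp
      ((Subgroup.top_lowerCentralSeries_one).trans (commutator_eq_bot G))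
    omega
  interval_cases k
  · refine ⟨1, frattini_nongenerating (K := Subgroup.zpowers 1) ?_⟩
    have htop : frattini G = ⊤ := Subgroup.index_eq_one.mp (by simpa using hk)
    rw [htop, sup_top_eq]
  · have hco := isCoatom_of_index_eq_prime Fact.out (hk.trans (pow_one p))
    obtain ⟨g, hg⟩ : ∃ g, g ∉ frattini G := by
      by_contra! h
      exact hco.1 (eq_top_iff.mpr fun x _ => h x)
    refine ⟨g, frattini_nongenerating (hco.2 _ (lt_of_le_of_ne le_sup_right fun h => hg ?_))⟩
    rw [h]
    exact (le_sup_left : Subgroup.zpowers g ≤ _) (Subgroup.mem_zpowers g)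

/-- A squeeze: |G : G'| ≥ p² bounds the exponents above, and strict descent down to the trivial term
bounds them below. -/
theorem card_lowerCentralSeries {k : ℕ} (hk : 1 ≤ k) (hkn : k ≤ n - 1) :
    Nat.card ((⊤ : Subgroup G).lowerCentralSeries k) = p ^ (n - 1 - k) := by
  have := hG.finite
  have hp := Fact.out (p := p.Prime)
  choose c hc using fun k => IsPGroup.iff_card.mp
    (hG.isPGroup.to_subgroup ((⊤ : Subgroup G).lowerCentralSeries k))
  have hlt (k : ℕ) (hk : k < n - 1) : c (k + 1) < c k := by
    have h := Set.ncard_lt_ncard (SetLike.coe_ssubset_coe.mpr (hG.lowerCentralSeries_succ_lt hk))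
    have h' : Nat.card ((⊤ : Subgroup G).lowerCentralSeries (k + 1)) <
      Nat.card ((⊤ : Subgroup G).lowerCentralSeries k) := h
    rw [hc, hc] at h'
    exact (Nat.pow_lt_pow_iff_right hp.one_lt).mp h'
  have h1 : c 1 ≤ n - 2 := by
    obtain ⟨j, hj⟩ := hG.isPGroup.index (frattini G)
    have hj2 := hG.two_le_of_index_frattini_eq hn hj
    have hle := hG.isPGroup.commutator_le_frattini
    rw [← Subgroup.top_lowerCentralSeries_one] at hle
    have hi := Subgroup.index_dvd_of_le hle
    have hm := Subgroup.index_mul_card ((⊤ : Subgroup G).lowerCentralSeries 1)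
    obtain ⟨i, hi'⟩ := hG.isPGroup.index ((⊤ : Subgroup G).lowerCentralSeries 1)
    rw [hj, hi', Nat.pow_dvd_pow_iff_le_right hp.one_lt] at hi
    rw [hi', hc, hG.card_eq, ← pow_add] at hm
    have := Nat.pow_right_injective hp.two_le hm
    omega
  have hup (m : ℕ) (hm : m + 1 ≤ n - 1) : c (m + 1) + m ≤ n - 2 := by
    induction m with
    | zero => simpa using h1
    | succ m ih => have := hlt (m + 1) (by omega); have := ih (by omega); omega
  have hdown (m : ℕ) (hm : m ≤ n - 1) : m ≤ c (n - 1 - m) := by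
    induction m with
    | zero => exact Nat.zero_le _
    | succ m ih =>
      have := hlt (n - 1 - (m + 1)) (by omega)
      rw [show n - 1 - (m + 1) + 1 = n - 1 - m by omega] at this
      have := ih (by omega)
      omega
  rw [hc]
  congr 1
  have h2 := hup (k - 1) (by omega)
  have h3 := hdown (n - 1 - k) (by omega)
  rw [show k - 1 + 1 = k by omega] at h2
  rw [show n - 1 - (n - 1 - k) = k by omega] at h3
  omega

theorem frattini_eq_commutator_and_index :
    frattini G = commutator G ∧ (frattini G).index = p ^ 2 := by
  have := hG.finite
  have hp := Fact.out (p := p.Prime)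
  have hcard := hG.card_lowerCentralSeries hn le_rfl (by omega)
  rw [Subgroup.top_lowerCentralSeries_one] at hcard
  have hi : (commutator G).index = p ^ 2 := by
    have hm := Subgroup.index_mul_card (commutator G)
    rw [hcard, hG.card_eq, show p ^ n = p ^ 2 * p ^ (n - 1 - 1) by rw [← pow_add]; congr 1; omega]
      at hm
    exact Nat.eq_of_mul_eq_mul_right (pow_pos hp.pos _) hm
  have hle := hG.isPGroup.commutator_le_frattini
  obtain ⟨j, hj⟩ := hG.isPGroup.index (frattini G)
  have hj2 := hG.two_le_of_index_frattini_eq hn hj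
  have hd := Subgroup.index_dvd_of_le hle
  rw [hj, hi, Nat.pow_dvd_pow_iff_le_right hp.one_lt] at hd
  obtain rfl : j = 2 := by omega
  refine ⟨le_antisymm ?_ hle, hj⟩
  have h1 := Subgroup.relIndex_mul_index hle
  rw [hj, hi, Nat.mul_eq_right (pow_ne_zero 2 hp.ne_zero)] at h1
  exact Subgroup.relIndex_eq_one.mp h1

theorem relIndex_lowerCentralSeries {k : ℕ} (hk : 1 ≤ k) (hkn : k < n - 1) :
    ((⊤ : Subgroup G).lowerCentralSeries (k + 1)).relIndex
      ((⊤ : Subgroup G).lowerCentralSeries k) = p := by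
  have hp := Fact.out (p := p.Prime)
  have h := Subgroup.relIndex_mul_relIndex ⊥ _ _ bot_le
    ((⊤ : Subgroup G).lowerCentralSeries_antitone (Nat.le_succ k))
  rw [Subgroup.relIndex_bot_left, Subgroup.relIndex_bot_left,
    hG.card_lowerCentralSeries hn hk (by omega),
    hG.card_lowerCentralSeries hn (by omega) (by omega),
    show n - 1 - k = n - 1 - (k + 1) + 1 by omega, pow_succ] at h
  exact Nat.eq_of_mul_eq_mul_left (pow_pos hp.pos _) h

omit [Fact p.Prime] in
theorem gOne_ne_top : gOne G ≠ ⊤ := by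
  intro h
  refine (hG.lowerCentralSeries_succ_lt (k := 2) (by omega)).not_ge ?_
  rw [Subgroup.lowerCentralSeries_succ _ 1, Subgroup.commutator_le]
  exact fun a ha g _ => mem_gOne_iff.mp (h ▸ Subgroup.mem_top g) a ha

/-- γ_2/γ_3 has order p, so any b ∈ γ_2 ∖ γ_3 generates γ_2 modulo γ_3, and γ_3 is central modulo
γ_4. -/
theorem exists_forall_mem_gOne_iff : ∃ b ∈ (⊤ : Subgroup G).lowerCentralSeries 1,
    ∀ g, g ∈ gOne G ↔ ⁅b, g⁆ ∈ (⊤ : Subgroup G).lowerCentralSeries 3 := by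
  have hp := Fact.out (p := p.Prime)
  obtain ⟨b, hb, hb2⟩ := SetLike.exists_of_lt (hG.lowerCentralSeries_succ_lt (k := 1) (by omega))
  refine ⟨b, hb, fun g => ⟨fun hg => mem_gOne_iff.mp hg b hb, fun hg => mem_gOne_iff.mpr ?_⟩⟩
  set C : Subgroup G := (Subgroup.centralizer {QuotientGroup.mk'
    ((⊤ : Subgroup G).lowerCentralSeries 3) g}).comap (QuotientGroup.mk' _) with hC
  have hmem (a : G) : a ∈ C ↔ ⁅a, g⁆ ∈ (⊤ : Subgroup G).lowerCentralSeries 3 := by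
    rw [hC, Subgroup.mem_comap, Subgroup.mem_centralizer_singleton_iff,
      ← commutatorElement_eq_one_iff_mul_comm, ← map_commutatorElement]
    exact QuotientGroup.eq_one_iff _
  have h2 : (⊤ : Subgroup G).lowerCentralSeries 2 ≤ C := fun a ha =>
    (hmem a).mpr (Subgroup.commutator_mem_commutator ha (Subgroup.mem_top g))
  have h21 := (⊤ : Subgroup G).lowerCentralSeries_antitone (show 1 ≤ 2 by norm_num)
  have h := Subgroup.relIndex_mul_relIndex _ _ _
    (le_inf h2 h21) (inf_le_right : C ⊓ (⊤ : Subgroup G).lowerCentralSeries 1 ≤ _)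
  rw [hG.relIndex_lowerCentralSeries hn le_rfl (by omega)] at h
  rcases (Nat.dvd_prime hp).mp (Dvd.intro_left _ h) with h1 | h1
  · intro a ha
    exact (hmem a).mp (Subgroup.relIndex_eq_one.mp h1 ha).1
  · rw [h1, Nat.mul_eq_right hp.ne_zero, Subgroup.relIndex_eq_one] at h
    exact absurd (h ⟨(hmem b).mpr hg, hb⟩) hb2

theorem index_gOne_and_commutator_le : (gOne G).index = p ∧ commutator G ≤ gOne G := by
  have := hG.finite
  have hp := Fact.out (p := p.Prime)
  obtain ⟨b, hb, hiff⟩ := hG.exists_forall_mem_gOne_iff hn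
  have hb2 (g : G) : ⁅b, g⁆ ∈ (⊤ : Subgroup G).lowerCentralSeries 2 :=
    Subgroup.commutator_mem_commutator hb (Subgroup.mem_top g)
  set N := (⊤ : Subgroup G).lowerCentralSeries 3
  have hcen (g : G) : (QuotientGroup.mk' N ⁅b, g⁆) ∈ Subgroup.center (G ⧸ N) := by
    rw [Subgroup.mem_center_iff]
    intro x
    obtain ⟨x, rfl⟩ := QuotientGroup.mk'_surjective N x
    rw [eq_comm, ← commutatorElement_eq_one_iff_mul_comm, ← map_commutatorElement]
    exact (QuotientGroup.eq_one_iff _).mpr (Subgroup.commutator_mem_commutator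
      (hb2 g) (Subgroup.mem_top x))
  -- G_1 is the kernel of g ↦ [b, g]γ_4, whose image lies in γ_3/γ_4 of order p.
  let ψ : G →* Subgroup.center (G ⧸ N) := MonoidHom.mk' (fun g => ⟨_, hcen g⟩) fun g h => by
    have h1 := Subgroup.mem_center_iff.mp (hcen h) (QuotientGroup.mk' N g)
    apply Subtype.ext
    change QuotientGroup.mk' N ⁅b, g * h⁆ = QuotientGroup.mk' N ⁅b, g⁆ * QuotientGroup.mk' N ⁅b, h⁆
    rw [commutatorElement_mul_right_eq_mul_conj, map_mul, map_mul, map_mul,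
      mul_assoc (QuotientGroup.mk' N ⁅b, g⁆), h1, map_inv, mul_assoc, mul_inv_cancel_right]
  have hker : ψ.ker = gOne G := by
    ext g
    rw [hiff, MonoidHom.mem_ker, ← Subtype.coe_inj]
    exact QuotientGroup.eq_one_iff _
  have hle : commutator G ≤ gOne G := by
    rw [← hker]
    rw [commutator_def, Subgroup.commutator_le]
    intro g _ h _
    rw [MonoidHom.mem_ker, map_commutatorElement, commutatorElement_eq_one_iff_mul_comm]
    exact Subtype.ext (Subgroup.mem_center_iff.mp (ψ h).2 _)
  refine ⟨?_, hle⟩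
  have hcard : ψ.ker.index ≤ p := by
    rw [Subgroup.index_ker]
    have hrange : ψ.range.map (Subgroup.subtype _) ≤
        ((⊤ : Subgroup G).lowerCentralSeries 2).map (QuotientGroup.mk' N) := by
      rintro _ ⟨_, ⟨g, rfl⟩, rfl⟩
      exact ⟨⁅b, g⁆, hb2 g, rfl⟩
    have hc2 : Nat.card (((⊤ : Subgroup G).lowerCentralSeries 2).map (QuotientGroup.mk' N)) = p := by
      rw [← Subgroup.relIndex_ker, QuotientGroup.ker_mk']
      exact hG.relIndex_lowerCentralSeries hn (k := 2) (by omega) (by omega)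
    rw [← hc2, ← Subgroup.card_map_of_injective (Subgroup.subtype_injective _)]
    exact Subgroup.card_le_of_le hrange
  rw [hker] at hcard
  obtain ⟨i, hi⟩ := hG.isPGroup.index (gOne G)
  have hi0 : i ≠ 0 := by
    rintro rfl
    exact hG.gOne_ne_top hn (Subgroup.index_eq_one.mp (by simpa using hi))
  have : i ≤ 1 := by
    rw [hi] at hcard
    exact (Nat.pow_le_pow_iff_right hp.one_lt).mp (hcard.trans_eq (pow_one p).symm)
  rw [hi, show i = 1 by omega, pow_one]

end IsMaximalClass

end MaximalClass

/-! ### The derived subgroup as a module -/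

section ConjugationModule

open Multiplicative
open scoped commutatorElement

universe u

/-- An abelian normal subgroup containing the derived subgroup is a faithful module over a
commutative ring through which the group acts by conjugation. -/
theorem exists_conjugation_module {G : Type u} [Group G] (A : Subgroup G) [A.Normal]
    [hA : IsMulCommutative A] (hGA : commutator G ≤ A) :
    ∃ (R V : Type u) (_ : CommRing R) (_ : AddCommGroup V) (_ : Module R V)
      (_ : FaithfulSMul R V) (e : Multiplicative V →* G) (ρ : G →* R),
      Function.Injective e ∧ e.range = A ∧
        ∀ g v, g * e (ofAdd v) * g⁻¹ = e (ofAdd (ρ g • v)) := by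
  let _ : CommGroup A := { (inferInstance : Group A) with mul_comm := hA.is_comm.comm }
  let ρ₀ : G →* AddMonoid.End (Additive A) :=
    { toFun := fun g => MonoidHom.toAdditive (MulAut.conjNormal g : MulAut A).toMonoidHom
      map_one' := by
        refine AddMonoidHom.ext fun a => Subtype.ext ?_
        change 1 * (a.toMul : G) * 1⁻¹ = a.toMul
        group
      map_mul' := fun g h => by
        refine AddMonoidHom.ext fun a => Subtype.ext ?_
        change g * h * (a.toMul : G) * (g * h)⁻¹ = g * (h * a.toMul * h⁻¹) * g⁻¹
        group }
  have hρ₀ (g : G) (a : Additive A) : ((ρ₀ g a).toMul : G) = g * a.toMul * g⁻¹ := rfl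
  -- Commutators lie in the abelian group A and act trivially on it, so the operators commute.
  have hcomm : ∀ x ∈ Set.range ρ₀, ∀ y ∈ Set.range ρ₀, x * y = y * x := by
    rintro _ ⟨g, rfl⟩ _ ⟨h, rfl⟩
    have h1 : ρ₀ ⁅g, h⁆ = 1 := by
      have hc : ⁅g, h⁆ ∈ A := hGA (Subgroup.commutator_mem_commutator trivial trivial)
      ext a
      have := congrArg Subtype.val (hA.is_comm.comm ⟨_, hc⟩ a.toMul)
      simp only [Subgroup.coe_mul] at this
      change ((ρ₀ ⁅g, h⁆ a).toMul : G) = a.toMul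
      rw [hρ₀, this, mul_inv_cancel_right]
    rw [← map_mul, ← map_mul, show g * h = ⁅g, h⁆ * (h * g) by rw [commutatorElement_def]; group,
      map_mul, h1, one_mul]
  have := Subring.isMulCommutative_closure hcomm
  let _ : CommRing (Subring.closure (Set.range ρ₀)) :=
    { (inferInstance : Ring (Subring.closure (Set.range ρ₀))) with mul_comm := this.is_comm.comm }
  refine ⟨Subring.closure (Set.range ρ₀), Additive A, inferInstance, inferInstance,
    inferInstance, ⟨fun h => Subtype.ext (AddMonoidHom.ext h)⟩,
    { toFun := fun v => (v.toAdd.toMul : G)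
      map_one' := rfl
      map_mul' := fun _ _ => rfl },
    ρ₀.codRestrict _ (fun g => Subring.subset_closure ⟨g, rfl⟩), ?_, ?_, fun g v => rfl⟩
  · exact fun v w h => Subtype.ext h
  · ext g
    exact ⟨fun ⟨v, hv⟩ => hv ▸ v.toAdd.toMul.2, fun hg => ⟨ofAdd (Additive.ofMul ⟨g, hg⟩), rfl⟩⟩

variable {G R V : Type*} [Group G] [CommRing R] [AddCommGroup V] [Module R V]
  {e : Multiplicative V →* G} {ρ : G →* R}

theorem commutatorElement_ofAdd_right (he : ∀ g v, g * e (ofAdd v) * g⁻¹ = e (ofAdd (ρ g • v)))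
    (g : G) (v : V) : ⁅g, e (ofAdd v)⁆ = e (ofAdd ((ρ g - 1) • v)) := by
  rw [commutatorElement_def, he, sub_smul, one_smul, ofAdd_sub, map_div, div_eq_mul_inv]

theorem commutatorElement_ofAdd_left (he : ∀ g v, g * e (ofAdd v) * g⁻¹ = e (ofAdd (ρ g • v)))
    (g : G) (v : V) : ⁅e (ofAdd v), g⁆ = e (ofAdd (-((ρ g - 1) • v))) := by
  rw [← commutatorElement_inv, commutatorElement_ofAdd_right he, ofAdd_neg, map_inv]

/-- The subgroup of `G` corresponding to a submodule. -/
def submoduleSubgroup (e : Multiplicative V →* G) (W : Submodule R V) : Subgroup G :=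
  W.toAddSubgroup.toSubgroup.map e

theorem submoduleSubgroup_normal (he : ∀ g v, g * e (ofAdd v) * g⁻¹ = e (ofAdd (ρ g • v)))
    (W : Submodule R V) : (submoduleSubgroup e W).Normal := by
  refine ⟨?_⟩
  rintro _ ⟨v, hv, rfl⟩ g
  exact ⟨ofAdd (ρ g • v.toAdd), W.smul_mem _ hv, (he g v.toAdd).symm⟩

theorem isNilpotent_sub_one [FaithfulSMul R V] [Group.IsNilpotent G] (hinj : Function.Injective e)
    (he : ∀ g v, g * e (ofAdd v) * g⁻¹ = e (ofAdd (ρ g • v))) (g : G) :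
    IsNilpotent (ρ g - 1) := by
  obtain ⟨n, hn⟩ := Subgroup.nilpotent_iff_lowerCentralSeries.mp ‹Group.IsNilpotent G›
  refine ⟨n, FaithfulSMul.eq_of_smul_eq_smul (α := V) fun v => ?_⟩
  have hmem (k : ℕ) : e (ofAdd ((ρ g - 1) ^ k • v)) ∈ (⊤ : Subgroup G).lowerCentralSeries k := by
    induction k with
    | zero => trivial
    | succ k ih =>
      rw [pow_succ', mul_smul, ← commutatorElement_ofAdd_right he, ← commutatorElement_inv,
        inv_mem_iff]
      exact Subgroup.commutator_mem_commutator ih (Subgroup.mem_top g)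
  have h := hmem n
  rw [hn, Subgroup.mem_bot, ← map_one e] at h
  rw [zero_smul]
  exact hinj h

theorem commutator_le_of_closure_pair {s t : G} (hst : Subgroup.closure {s, t} = ⊤)
    {N : Subgroup G} [N.Normal] (h : ⁅s, t⁆ ∈ N) : commutator G ≤ N := by
  rw [← Subgroup.Normal.quotient_commutative_iff_commutator_le]
  have hcomm : QuotientGroup.mk' N s * QuotientGroup.mk' N t =
      QuotientGroup.mk' N t * QuotientGroup.mk' N s := by
    rw [← commutatorElement_eq_one_iff_mul_comm, ← map_commutatorElement]
    exact (QuotientGroup.eq_one_iff _).mpr h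
  have hcl : IsMulCommutative (Subgroup.closure (QuotientGroup.mk' N '' {s, t})) := by
    refine Subgroup.isMulCommutative_closure ?_
    rintro _ ⟨x, rfl | rfl, rfl⟩ _ ⟨y, rfl | rfl, rfl⟩
    exacts [rfl, hcomm, hcomm.symm, rfl]
  have htop : Subgroup.closure (QuotientGroup.mk' N '' {s, t}) = ⊤ := by
    rw [← MonoidHom.map_closure, hst]
    exact Subgroup.map_top_of_surjective _ (QuotientGroup.mk'_surjective N)
  rw [htop] at hcl
  exact ⟨⟨fun x y => congrArg Subtype.val (hcl.is_comm.comm ⟨x, trivial⟩ ⟨y, trivial⟩)⟩⟩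

theorem sub_one_mem_span_pair {s t : G} (hst : Subgroup.closure {s, t} = ⊤) (g : G) :
    ρ g - 1 ∈ Ideal.span {ρ s - 1, ρ t - 1} := by
  set I := Ideal.span {ρ s - 1, ρ t - 1} with hI
  let φ : G →* R ⧸ I := (Ideal.Quotient.mk I : R →* R ⧸ I).comp ρ
  have hφ (g : G) : g ∈ φ.ker ↔ ρ g - 1 ∈ I := by
    rw [MonoidHom.mem_ker, ← Ideal.Quotient.eq_zero_iff_mem, map_sub, map_one, sub_eq_zero]
    rfl
  rw [← hφ]
  have hle : Subgroup.closure {s, t} ≤ φ.ker := by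
    rw [Subgroup.closure_le]
    rintro _ (rfl | rfl)
    · exact (hφ _).mpr (Ideal.subset_span (by simp))
    · exact (hφ _).mpr (Ideal.subset_span (by simp))
  exact hle (hst ▸ Subgroup.mem_top g)

theorem commutator_submoduleSubgroup_le
    (he : ∀ g v, g * e (ofAdd v) * g⁻¹ = e (ofAdd (ρ g • v))) {I : Ideal R}
    (hI : ∀ g, ρ g - 1 ∈ I) (W : Submodule R V) :
    ⁅submoduleSubgroup e W, (⊤ : Subgroup G)⁆ ≤ submoduleSubgroup e (I • W) := by
  rw [Subgroup.commutator_le]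
  rintro _ ⟨v, hv, rfl⟩ g -
  have := commutatorElement_ofAdd_left he g v.toAdd
  rw [ofAdd_toAdd] at this
  rw [this]
  exact ⟨ofAdd (-((ρ g - 1) • v.toAdd)),
    (I • W).neg_mem (Submodule.smul_mem_smul (hI g) hv), rfl⟩

/-- As s and t generate G, the commutator [s, t] generates V as a module, and γ_4 lies in the
subgroup of I²V with I = (ρ s - 1, ρ t - 1). Membership of t in G_1 puts (ρ t - 1)V into I²V. -/
theorem exists_sub_one_eq_sq_mul [FaithfulSMul R V] [Group.IsNilpotent G]
    (hinj : Function.Injective e) (hrange : e.range = commutator G)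
    (he : ∀ g v, g * e (ofAdd v) * g⁻¹ = e (ofAdd (ρ g • v))) {s t : G}
    (hst : Subgroup.closure {s, t} = ⊤) (ht : t ∈ gOne G) :
    ∃ y, ρ t - 1 = (ρ s - 1) ^ 2 * y := by
  obtain ⟨b, hb⟩ : ⁅s, t⁆ ∈ e.range :=
    hrange ▸ Subgroup.commutator_mem_commutator (Subgroup.mem_top s) (Subgroup.mem_top t)
  have hI := sub_one_mem_span_pair (ρ := ρ) hst
  set I := Ideal.span {ρ s - 1, ρ t - 1}
  have h1 : (⊤ : Subgroup G).lowerCentralSeries 1 ≤ submoduleSubgroup e (⊤ : Submodule R V) := by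
    rw [Subgroup.top_lowerCentralSeries_one, ← hrange]
    rintro _ ⟨v, rfl⟩
    exact ⟨v, trivial, rfl⟩
  have h2 : (⊤ : Subgroup G).lowerCentralSeries 2 ≤
      submoduleSubgroup e (I • (⊤ : Submodule R V)) :=
    (Subgroup.commutator_mono h1 le_rfl).trans (commutator_submoduleSubgroup_le he hI _)
  have h3 : (⊤ : Subgroup G).lowerCentralSeries 3 ≤
      submoduleSubgroup e (I • I • (⊤ : Submodule R V)) :=
    (Subgroup.commutator_mono h2 le_rfl).trans (commutator_submoduleSubgroup_le he hI _)
  refine exists_eq_sq_mul_of_smul_mem (b := b.toAdd) (isNilpotent_sub_one hinj he s)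
    (isNilpotent_sub_one hinj he t) ?_ fun v => ?_
  · have := submoduleSubgroup_normal he (Submodule.span R {b.toAdd})
    have hle := commutator_le_of_closure_pair hst (N := submoduleSubgroup e (Submodule.span R
      {b.toAdd})) (hb ▸ ⟨b, Submodule.mem_span_singleton_self (R := R) b.toAdd, rfl⟩)
    rw [← hrange] at hle
    refine eq_top_iff.mpr fun v _ => ?_
    obtain ⟨w, hw, hwv⟩ := hle ⟨ofAdd v, rfl⟩
    obtain rfl : w = ofAdd v := hinj hwv
    exact hw
  · have hv : e (ofAdd v) ∈ (⊤ : Subgroup G).lowerCentralSeries 1 := by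
      rw [Subgroup.top_lowerCentralSeries_one, ← hrange]
      exact ⟨_, rfl⟩
    have hmem := mem_gOne_iff.mp ht _ hv
    rw [commutatorElement_ofAdd_left he] at hmem
    obtain ⟨w, hw, hwv⟩ := h3 hmem
    have hw' : w = ofAdd (-((ρ t - 1) • v)) := hinj hwv
    rw [hw'] at hw
    exact neg_mem_iff.mp hw

end ConjugationModule

/-! ### Assembly of the three cases -/

theorem closure_pair_eq_top {G : Type*} [Group G] [Finite G] {p : ℕ} [Fact p.Prime]
    (hG : IsPGroup p G) (hΦ : (frattini G).index = p ^ 2) {H : Subgroup G} (hH : IsCoatom H)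
    {s t : G} (hs : s ∉ H) (ht : t ∈ H) (htΦ : t ∉ frattini G) :
    Subgroup.closure {s, t} = ⊤ := by
  refine frattini_nongenerating (hH.2 _ (lt_of_le_of_ne ?_ ?_))
  · rw [hH.eq_frattini_sup_zpowers hG hΦ ht htΦ]
    exact sup_le le_sup_right (le_sup_of_le_left
      (Subgroup.zpowers_le.mpr (Subgroup.subset_closure (by simp))))
  · intro h
    refine hs (h ▸ ?_)
    exact (le_sup_left : Subgroup.closure {s, t} ≤ _) (Subgroup.subset_closure (by simp))

open scoped commutatorElement in
theorem IsMaximalClass.mul_pow_eq_one_of_metabelian {p n : ℕ} [Fact p.Prime] (h5 : 5 ≤ p)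
    (hn : 4 ≤ n) {G : Type*} [Group G] (hG : IsMaximalClass p n G) (hmet : IsMetabelianGroup G)
    {s t : G} (hs : s ∉ gOne G) (ht : t ∈ gOne G) (htΦ : t ∉ frattini G) {j : ℕ} (hj : 2 ≤ j)
    (hjp : j < p) (h0 : ∀ a ∈ frattini G, (a * s) ^ p = 1)
    (h1 : ∀ a ∈ frattini G, (a * (t * s)) ^ p = 1)
    (h2 : ∀ a ∈ frattini G, (a * (t ^ j * s)) ^ p = 1) (k : ℕ) (a : G) (ha : a ∈ frattini G) :
    (a * (t ^ k * s)) ^ p = 1 := by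
  have := hG.finite
  have := hG.isNilpotent
  obtain ⟨hΦ, hΦi⟩ := hG.frattini_eq_commutator_and_index hn
  have hst := closure_pair_eq_top hG.isPGroup hΦi
    (isCoatom_of_index_eq_prime Fact.out (hG.index_gOne_and_commutator_le hn).1) hs ht htΦ
  have hA : IsMulCommutative (commutator G) :=
    Subgroup.commutator_self_eq_bot_iff.mp hmet
  obtain ⟨R, V, _, _, _, _, e, ρ, hinj, hrange, he⟩ :=
    exists_conjugation_module (commutator G) le_rfl
  obtain ⟨y, hy⟩ := exists_sub_one_eq_sq_mul hinj hrange he hst ht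
  obtain ⟨b, hb⟩ : ⁅s, t⁆ ∈ e.range :=
    hrange ▸ Subgroup.commutator_mem_commutator (Subgroup.mem_top s) (Subgroup.mem_top t)
  rw [hΦ, ← hrange] at h0 h1 h2 ha
  refine pow_eq_one_of_three hinj he Fact.out h5 (fun g => ?_) (b := b.toAdd) ?_ hy
    (isNilpotent_sub_one hinj he s) hj hjp h0 h1 ?_ k a ha
  · rw [hrange, ← hΦ]
    exact hG.isPGroup.pow_mem_frattini g
  · rw [ofAdd_toAdd, hb, commutatorElement_def]
    group
  · simpa using h2 1 (one_mem _)

theorem commute_of_nilpotencyClass_le_two {G : Type*} [Group G] [Group.IsNilpotent G]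
    {H : Subgroup G} (hH : Group.nilpotencyClass H ≤ 2) :
    ∀ c ∈ ⁅H, H⁆, ∀ h ∈ H, Commute c h := by
  rw [← Subgroup.lowerCentralSeries_eq_bot_iff_nilpotencyClass_le] at hH
  have h2 := Subgroup.top_subtype_lowerCentralSeries H 2
  rw [hH, Subgroup.map_bot] at h2
  intro c hc h hh
  rw [← commutatorElement_eq_one_iff_commute, ← Subgroup.mem_bot, h2]
  exact Subgroup.commutator_mem_commutator hc hh

/-- A translate of `t ^ k * s` by an element of a normal subgroup absorbs into `s`. -/
theorem forall_mul_pow_eq_one_iff {G : Type*} [Group G] {N : Subgroup G} [N.Normal] {p k : ℕ}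
    {s t : G} :
    (∀ a ∈ N, (a * (t ^ k * s)) ^ p = 1) ↔ ∀ a ∈ N, (t ^ k * (a * s)) ^ p = 1 := by
  refine ⟨fun h a ha => ?_, fun h a ha => ?_⟩
  · rw [← h _ (‹N.Normal›.conj_mem a ha (t ^ k))]
    congr 1
    group
  · rw [← h _ (‹N.Normal›.conj_mem a ha (t ^ k)⁻¹)]
    congr 1
    group

theorem theorem2p2 (p n : ℕ) (hp : p.Prime) (hn : 4 ≤ n) (G : Type*) [Group G]
    (hG : IsMaximalClass p n G) :
    ((IsMetabelianGroup G ∨ Group.nilpotencyClass (gOne G) ≤ 2) →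
      mu p G = 0 ∨ mu p G = 1 ∨ mu p G = 2 ∨ mu p G = p) ∧
    ((∃ A : Subgroup G, IsCoatom A ∧ IsMulCommutative A) →
      mu p G = 0 ∨ mu p G = 1 ∨ mu p G = p) := by
  have : Fact p.Prime := ⟨hp⟩
  have := hG.finite
  have := hG.isNilpotent
  have hP := hG.isPGroup
  obtain ⟨hΦ, hΦi⟩ := hG.frattini_eq_commutator_and_index hn
  have hH := isCoatom_of_index_eq_prime hp (hG.index_gOne_and_commutator_le hn).1
  have hHn := hP.normal_of_isCoatom hH
  refine ⟨?_, ?_⟩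
  · rintro (hmet | hcl)
    · by_cases h5 : 5 ≤ p
      · exact ncard_eq_of_three hP hΦi hH (fun s hs t ht htΦ j hj hjp h0 h1 h2 =>
          hG.mul_pow_eq_one_of_metabelian h5 hn hmet hs ht htΦ hj hjp h0 h1 h2) rfl
      -- For p = 2, 3 every value up to p is allowed.
      · have hle : mu p G ≤ p := ncard_le_prime hP hΦi hH
        have : p ≠ 4 := by rintro rfl; norm_num at hp
        have := hp.two_le
        omega
    · have hcomm := commute_of_nilpotencyClass_le_two hcl
      refine ncard_eq_of_three hP hΦi hH (fun s hs t ht htΦ j hj hjp h0 h1 h2 k => ?_) rfl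
      -- With exponent 1 written out, a can be absorbed into s in all the hypotheses; the criterion
      -- is then applied to a * s.
      rw [← pow_one t] at h1
      rw [forall_mul_pow_eq_one_iff] at h1 h2 ⊢
      intro a ha
      exact mul_pow_eq_one_of_commute_commutator hcomm hp hP ht hj hjp (h0 a ha)
        (by simpa using h1 a ha) (h2 a ha) k
  · rintro ⟨A, hA, hAc⟩
    -- A contains Φ(G) = γ_2 and centralizes it, so A ≤ G_1, and both are maximal.
    have hAG : A = gOne G := by
      have hle : A ≤ gOne G := fun x hx => mem_gOne_iff.mpr fun a ha => by
        rw [Subgroup.top_lowerCentralSeries_one, ← hΦ] at ha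
        have := congrArg Subtype.val (hAc.is_comm.comm ⟨a, frattini_le_coatom hA ha⟩ ⟨x, hx⟩)
        rw [commutatorElement_eq_one_iff_mul_comm.mpr this]
        exact one_mem _
      by_contra hne
      exact hH.1 (hA.2 _ (lt_of_le_of_ne hle hne))
    subst hAG
    refine ncard_eq_of_two hP hΦi hH (fun s hs t ht h0 h1 k => ?_) rfl
    rw [← pow_one t] at h1
    rw [forall_mul_pow_eq_one_iff] at h1 ⊢
    intro a ha
    exact mul_pow_eq_one_of_isMulCommutative ht (h0 a ha) (by simpa using h1 a ha) k
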